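/- Let $n,p\ge 1$. Let $(x,c)\in\mathbb{R}^p\times\mathbb{R}$ be a random vector with law $Q$, let $\varepsilon$ be a real error, independent of $(x,c)$, with distribution function $\nu_0$, and let $(x_i,c_i,\varepsilon_i)$, $i=1,\dots,n$, be i.i.d. copies of $(x,c,\varepsilon)$. For $\beta^0\in\mathbb{R}^p$ observe $x_i$, $c_i$ and $y_i=\max\{c_i,\,x_i\beta^0+\varepsilon_i\}$; let $y=\max\{c,\,x\beta^0+\varepsilon\}$ and assume $\mathbb{E}|y|<\infty$. Write $f_\beta(x,c)=\max\{x\beta,c\}$, $f_0(x,c)=\arg\min_a \mathbb{E}[\,|y-a|\mid x,c\,]$, $\mathcal{E}(f)=\mathbb{E}|y-f(x,c)|-\mathbb{E}|y-f_0(x,c)|$, $\|f\|_2^2=\mathbb{E}f^2(x,c)$, $S=\{j:\beta^0_j\ne 0\}$, $s_{\beta^0}=|S|$, and $(v_A)_j=v_j\mathbf 1\{j\in A\}$ for $v\in\mathbb{R}^p$, $A\subset\{1,\dots,p\}$. Let $\mathcal{B}\subset\mathbb{R}^p$ be a bounded set with $\beta^0\in\mathcal{B}$, and let $\hat\beta$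 be any minimiser over $\beta\in\mathcal{B}$ of $$\frac1n\sum_{i=1}^n\big|y_i-\max\{c_i,x_i\beta\}\big|+\lambda\|\beta\|_1 .$$ Assume: 1. $\max_j|x_j|\le K_X$ almost surely. 2. For all $\beta\in\mathcal{B}$, $x(\beta-\beta^0)$ and $f_0(x,c)-f_\beta(x,c)$ lie in $[-K_0,K_0]$ almost surely. 3. $\mathbb{E}x_j^2=1$ for all $j$. 4. $f_0(x,c)$ is uniquely defined (almost surely). 5. $\nu_0$ has median $0$ and is continuously differentiable, its derivative $\dot\nu_0$ is Lipschitz with constant $L$, and $\dot\nu_0(0)>0$. 6. For some $C_2>0$ and all $\beta$ with $\|(\beta-\beta^0)_{S^c}\|_1\le 3\|(\beta-\beta^0)_S\|_1$: $\|f_\beta-f_0\|_2^2\ge C_2\,\|x(\beta-\beta^0)\|_2^2$. 7. For some $\phi_0>0$ and all $\beta$ as in 6: $\|(\beta-\beta^0)_S\|_1^2\le(\beta-\beta^0)^T\,\mathbb{E}[x^Tx]\,(\beta-\beta^0)\,s_{\beta^0}/\phi_0^2$. For $t\ge 0$ let $$\lambda(t)=4K_X\sqrt{\frac{2\log(2p)}{n}}+K_X\sqrt{\frac{8t}{n}}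 .$$ Then there is a constant $C>0$, depending only on $K_0$, $C_2$, $\dot\nu_0(0)$ and $L$, such that for every $t\ge0$ and every $\lambda\ge4\lambda(t)$, with probability at least $1-1/p$, $$\mathcal{E}(f_{\hat\beta})\le\lambda^2\,\frac{9\,s_{\beta^0}C}{\phi_0^2}\qquad\text{and}\qquad \|\hat\beta-\beta^0\|_1\le\lambda\,\frac{6\,C\,s_{\beta^0}}{\phi_0^2}.$$ -/

import Mathlib

open MeasureTheory ProbabilityTheory
open scoped NNReal

noncomputable section

namespace CensoredLinear

/-- The censored response `y = max {c, xβ⁰ + e}` for the pair `z = (x, c)` and the error `e`. -/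
def response {p : ℕ} (β0 : Fin p → ℝ) (z : (Fin p → ℝ) × ℝ) (e : ℝ) : ℝ :=
  max z.2 (z.1 ⬝ᵥ β0 + e)

/-- The prediction function `f_β(x, c) = xβ ∨ c`. -/
def predictor {p : ℕ} (β : Fin p → ℝ) (z : (Fin p → ℝ) × ℝ) : ℝ :=
  max (z.1 ⬝ᵥ β) z.2

/-- The ℓ¹ norm of a coefficient vector. -/
def l1Norm {p : ℕ} (β : Fin p → ℝ) : ℝ := ∑ j, |β j|

/-- The active set `S_β = {j : β_j ≠ 0}`. -/
def activeSet {p : ℕ} (β : Fin p → ℝ) : Finset (Fin p) := Finset.univ.filter fun j => β j ≠ 0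

/-- The vector `β_S`, equal to `β` on `S` and to zero off `S`. -/
def restrictTo {p : ℕ} (S : Finset (Fin p)) (β : Fin p → ℝ) : Fin p → ℝ :=
  fun j => if j ∈ S then β j else 0

/-- `β` satisfies `‖(β - β⁰)_{Sᶜ}‖₁ ≤ 3 ‖(β - β⁰)_S‖₁`, where `S` is the active set of `β⁰`. -/
def InCone {p : ℕ} (β0 β : Fin p → ℝ) : Prop :=
  l1Norm (restrictTo (activeSet β0)ᶜ (β - β0)) ≤ 3 * l1Norm (restrictTo (activeSet β0) (β - β0))

/-- `E[|y - a| | x, c]` at `z = (x, c)`. The error has law `ν` and is independent of `(x, c)`, so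
conditionally on `(x, c) = z` the response is distributed as `response β0 z e` with `e ∼ ν`. -/
def condRisk {p : ℕ} (ν : Measure ℝ) (β0 : Fin p → ℝ) (z : (Fin p → ℝ) × ℝ) (a : ℝ) : ℝ :=
  ∫ e, |response β0 z e - a| ∂ν

/-- `a` minimises `E[|y - ·| | x, c]` at `z = (x, c)`. -/
def IsCondMinimizer {p : ℕ} (ν : Measure ℝ) (β0 : Fin p → ℝ) (z : (Fin p → ℝ) × ℝ) (a : ℝ) :
    Prop :=
  ∀ b, condRisk ν β0 z a ≤ condRisk ν β0 z b

/-- `f₀(x, c) = argmin_a E[|y - a| | x, c]`. -/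
def bestPredictor {p : ℕ} (ν : Measure ℝ) (β0 : Fin p → ℝ) (z : (Fin p → ℝ) × ℝ) : ℝ :=
  Classical.epsilon (IsCondMinimizer ν β0 z)

/-- The theoretical risk `E |y - f(x, c)|`, where `((x, c), ε) ∼ Q ⊗ ν`. -/
def risk {p : ℕ} (Q : Measure ((Fin p → ℝ) × ℝ)) (ν : Measure ℝ) (β0 : Fin p → ℝ)
    (f : (Fin p → ℝ) × ℝ → ℝ) : ℝ :=
  ∫ w, |response β0 w.1 w.2 - f w.1| ∂(Q.prod ν)

/-- The excess risk of `f` over `f₀`. -/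
def excessRisk {p : ℕ} (Q : Measure ((Fin p → ℝ) × ℝ)) (ν : Measure ℝ) (β0 : Fin p → ℝ)
    (f : (Fin p → ℝ) × ℝ → ℝ) : ℝ :=
  risk Q ν β0 f - risk Q ν β0 (bestPredictor ν β0)

/-- The second moment matrix `E[xᵀ x]` of the (row) vector `x`. -/
def secondMoment {p : ℕ} (Q : Measure ((Fin p → ℝ) × ℝ)) : Matrix (Fin p) (Fin p) ℝ :=
  fun j k => ∫ z, z.1 j * z.1 k ∂Q

/-- The penalised empirical risk `n⁻¹ ∑ |y_i - max {c_i, x_i β}| + lam ‖β‖₁`. -/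
def criterion {n p : ℕ} (x : Fin n → Fin p → ℝ) (c y : Fin n → ℝ) (lam : ℝ) (β : Fin p → ℝ) : ℝ :=
  (1 / (n : ℝ)) * ∑ i, |y i - max (c i) (x i ⬝ᵥ β)| + lam * l1Norm β

/-- `b` is a value of the penalised estimator: a minimiser of the criterion over `B`. -/
def IsEstimate {n p : ℕ} (B : Set (Fin p → ℝ)) (x : Fin n → Fin p → ℝ) (c y : Fin n → ℝ)
    (lam : ℝ) (b : Fin p → ℝ) : Prop :=
  b ∈ B ∧ ∀ β ∈ B, criterion x c y lam b ≤ criterion x c y lam β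

/-- `lam(t) = 4 K_X √(2 log(2p) / n) + K_X √(8 t / n)`. -/
def lambdaFun (n p : ℕ) (KX t : ℝ) : ℝ :=
  4 * KX * Real.sqrt (2 * Real.log (2 * p) / n) + KX * Real.sqrt (8 * t / n)

/-- The `(x_i, c_i)` are i.i.d. with law `Q`, the `ε_i` are i.i.d. with law `ν`, and
errors are independent of covariates and censoring levels. -/
structure IsSample {Ω : Type*} [MeasurableSpace Ω] (P : Measure Ω) {n p : ℕ}
    (Q : Measure ((Fin p → ℝ) × ℝ)) (ν : Measure ℝ)
    (x : Fin n → Ω → Fin p → ℝ) (c ε : Fin n → Ω → ℝ) : Prop where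
  indep : iIndepFun (fun i ω => ((x i ω, c i ω), ε i ω)) P
  law : ∀ i, HasLaw (fun ω => ((x i ω, c i ω), ε i ω)) (Q.prod ν) P

/-- Bounded design: `|x_j| ≤ K_X`. -/
def BoundedDesign {p : ℕ} (Q : Measure ((Fin p → ℝ) × ℝ)) (KX : ℝ) : Prop :=
  ∀ j, ∀ᵐ z ∂Q, |z.1 j| ≤ KX

/-- `x(β - β⁰)` and `f₀ - f_β` take values in `[-K₀, K₀]`, for every `β ∈ B`. -/
def BoundedPredictions {p : ℕ} (Q : Measure ((Fin p → ℝ) × ℝ)) (ν : Measure ℝ)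
    (β0 : Fin p → ℝ) (B : Set (Fin p → ℝ)) (K0 : ℝ) : Prop :=
  ∀ β ∈ B, ∀ᵐ z ∂Q, z.1 ⬝ᵥ (β - β0) ∈ Set.Icc (-K0) K0 ∧
    bestPredictor ν β0 z - predictor β z ∈ Set.Icc (-K0) K0

/-- Scaling: `E x_j² = 1`. -/
def Scaled {p : ℕ} (Q : Measure ((Fin p → ℝ) × ℝ)) : Prop :=
  ∀ j, ∫ z, z.1 j ^ 2 ∂Q = 1

/-- `f₀` is uniquely defined. -/
def UniqueBestPredictor {p : ℕ} (Q : Measure ((Fin p → ℝ) × ℝ)) (ν : Measure ℝ)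
    (β0 : Fin p → ℝ) : Prop :=
  ∀ᵐ z ∂Q, ∃! a, IsCondMinimizer ν β0 z a

/-- The error distribution function is continuously differentiable with median `0`, its derivative
is Lipschitz with constant `L`, and this derivative has the value `d > 0` at `0`. -/
structure ErrorCondition (ν : Measure ℝ) (L : ℝ≥0) (d : ℝ) : Prop where
  median : cdf ν 0 = 1 / 2
  contDiff : ContDiff ℝ 1 (cdf ν)
  lipschitz : LipschitzWith L (deriv (cdf ν))
  deriv_zero : deriv (cdf ν) 0 = d
  pos : 0 < d

/-- Censoring condition: `‖f_β - f₀‖² ≥ C₂ ‖x(β - β⁰)‖²` (norms of `L²(Q)`) on the cone. -/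
def CensoringCondition {p : ℕ} (Q : Measure ((Fin p → ℝ) × ℝ)) (ν : Measure ℝ)
    (β0 : Fin p → ℝ) (C2 : ℝ) : Prop :=
  ∀ β, InCone β0 β →
    C2 * ∫ z, (z.1 ⬝ᵥ (β - β0)) ^ 2 ∂Q ≤ ∫ z, (predictor β z - bestPredictor ν β0 z) ^ 2 ∂Q

/-- Compatibility condition for the active set of `β⁰`, with constant `φ₀`. -/
def CompatibilityCondition {p : ℕ} (Q : Measure ((Fin p → ℝ) × ℝ)) (β0 : Fin p → ℝ)
    (φ0 : ℝ) : Prop :=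
  ∀ β, InCone β0 β →
    l1Norm (restrictTo (activeSet β0) (β - β0)) ^ 2 ≤
      ((β - β0) ⬝ᵥ (secondMoment Q).mulVec (β - β0)) * ((activeSet β0).card / φ0 ^ 2)

end CensoredLinear

end

/-! Censoring is monotone, so the conditional median of `y` is `predictor β0`, and `f₀` agrees with
it almost everywhere. Near `0` the error distribution function has slope at least `d / 2`, so the
conditional risk, hence the excess risk, grows quadratically around `f₀`
(`ErrorCondition.excessRisk_margin`).

The probabilistic task is to bound the empirical process of loss differences by `n * (lam / 2) *
‖δ‖₁` for all `δ` at once. Divided by `‖δ‖₁`, a loss difference depends only on the scale `q = 1 /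
‖δ‖₁` and the direction `θ = δ / ‖δ‖₁`. Since `|xθ| ≤ K_X`, residual and censoring level may be
truncated at `K_X` without changing it (`abs_clip_sub_max_clip`). The normalised class is thus
uniformly bounded, and no peeling over `‖δ‖₁` is needed. Contraction splits its Rademacher average
into a linear part, bounded by `K √(2 log (2p)) √n`, and truncated multiples of fixed numbers, which
a random-walk argument bounds by `K √n` uniformly in the scale (`signedMax_censored_le`).
Symmetrization and bounded differences turn this into a tail bound; a dense sequence and continuity
in `δ` then give the event for every `δ`.

On that event the usual Lasso argument applies: minimality of `b` gives the basic inequality and the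
cone condition, and margin, censoring and compatibility close the estimate
(`IsEstimate.oracle_bounds`). -/

noncomputable section

namespace CensoredLinear

/-! ### Rademacher averages over finite classes: contraction and subadditivity. -/

section Rademacher

variable {ι T : Type*} [Fintype T] [Nonempty T]

/-- The maximum of a function on a finite nonempty type. -/
def maxOver (A : T → ℝ) : ℝ := Finset.univ.sup' Finset.univ_nonempty A

lemma le_maxOver (A : T → ℝ) (t : T) : A t ≤ maxOver A :=
  Finset.le_sup' A (Finset.mem_univ t)

lemma maxOver_le {A : T → ℝ} {b : ℝ} (h : ∀ t, A t ≤ b) : maxOver A ≤ b :=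
  Finset.sup'_le _ _ fun t _ => h t

lemma exists_maxOver_eq (A : T → ℝ) : ∃ t, maxOver A = A t := by
  obtain ⟨t, -, h⟩ := Finset.exists_mem_eq_sup' (Finset.univ_nonempty (α := T)) A
  exact ⟨t, h⟩

/-- The average over all signs of `max_t (A t + ∑ ± φ i t)`, the sum running over the list. -/
def signedMax (φ : ι → T → ℝ) : (T → ℝ) → List ι → ℝ
  | A, [] => maxOver A
  | A, i :: l => (signedMax φ (A + φ i) l + signedMax φ (A - φ i) l) / 2

/-- At maximisers `s`, `t` of the two left terms, the increment `φ s - φ t` is at most `±(f s - f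
t)` for one sign; that sign decides which right-hand maximum is tested at `s` and which at `t`. -/
lemma maxOver_add_sub_le {A φ f : T → ℝ} (h : ∀ s t, |φ s - φ t| ≤ |f s - f t|) :
    maxOver (A + φ) + maxOver (A - φ) ≤ maxOver (A + f) + maxOver (A - f) := by
  obtain ⟨s, hs⟩ := exists_maxOver_eq (A + φ)
  obtain ⟨t, ht⟩ := exists_maxOver_eq (A - φ)
  have h1 := le_maxOver (A + f) s
  have h2 := le_maxOver (A + f) t
  have h3 := le_maxOver (A - f) s
  have h4 := le_maxOver (A - f) t
  have h5 := (le_abs_self _).trans (h s t)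
  simp only [Pi.add_apply, Pi.sub_apply] at *
  rcases abs_cases (f s - f t) with ⟨h6, _⟩ | ⟨h6, _⟩ <;> linarith

lemma signedMax_add_sub_le (ψ : ι → T → ℝ) {φ f : T → ℝ} (h : ∀ s t, |φ s - φ t| ≤ |f s - f t|)
    (l : List ι) (A : T → ℝ) :
    signedMax ψ (A + φ) l + signedMax ψ (A - φ) l ≤
      signedMax ψ (A + f) l + signedMax ψ (A - f) l := by
  induction l generalizing A with
  | nil => exact maxOver_add_sub_le h
  | cons i l ih =>
    have h1 := ih (A + ψ i)
    have h2 := ih (A - ψ i)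
    simp only [signedMax]
    rw [add_right_comm A φ, add_right_comm A f, add_sub_right_comm A φ, add_sub_right_comm A f,
      sub_add_eq_add_sub A φ, sub_add_eq_add_sub A f, sub_right_comm A φ, sub_right_comm A f]
    linarith

/-- Contraction principle, replacing one summand at a time. Comparing increments on the class
suffices, so no common Lipschitz map is needed, and without absolute values around the sums no
factor 2 is lost. -/
lemma signedMax_contraction {φ f : ι → T → ℝ} (h : ∀ i s t, |φ i s - φ i t| ≤ |f i s - f i t|)
    (l : List ι) (A : T → ℝ) : signedMax φ A l ≤ signedMax f A l := by
  induction l generalizing A with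
  | nil => exact le_rfl
  | cons i l ih =>
    have h1 := ih (A + φ i)
    have h2 := ih (A - φ i)
    have h3 := signedMax_add_sub_le f (h i) l A
    simp only [signedMax]
    linarith

lemma signedMax_add_le (φ ψ : ι → T → ℝ) (l : List ι) (A B : T → ℝ) :
    signedMax (fun i => φ i + ψ i) (A + B) l ≤ signedMax φ A l + signedMax ψ B l := by
  induction l generalizing A B with
  | nil => exact maxOver_le fun t => add_le_add (le_maxOver A t) (le_maxOver B t)
  | cons i l ih =>
    have h1 := ih (A + φ i) (B + ψ i)
    have h2 := ih (A - φ i) (B - ψ i)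
    simp only [signedMax]
    rw [add_add_add_comm A B, add_sub_add_comm A B]
    linarith

lemma signedMax_zero_add_le (φ ψ : ι → T → ℝ) (l : List ι) :
    signedMax (fun i => φ i + ψ i) 0 l ≤ signedMax φ 0 l + signedMax ψ 0 l := by
  simpa using signedMax_add_le φ ψ l 0 0

lemma signedMax_smul_le (φ : ι → T → ℝ) {c : ℝ} (hc : 0 ≤ c) (l : List ι) (A : T → ℝ) :
    signedMax (fun i => c • φ i) (c • A) l ≤ c * signedMax φ A l := by
  induction l generalizing A with
  | nil => exact maxOver_le fun t => mul_le_mul_of_nonneg_left (le_maxOver A t) hc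
  | cons i l ih =>
    have h1 := ih (A + φ i)
    have h2 := ih (A - φ i)
    simp only [signedMax]
    rw [← smul_add, ← smul_sub]
    linarith

lemma signedMax_perm (φ : ι → T → ℝ) {l l' : List ι} (h : l.Perm l') (A : T → ℝ) :
    signedMax φ A l = signedMax φ A l' := by
  induction h generalizing A with
  | nil => rfl
  | cons i _ ih => simp only [signedMax, ih]
  | swap i j l =>
    simp only [signedMax]
    rw [add_right_comm A (φ i), sub_add_eq_add_sub A (φ i), add_sub_right_comm A (φ i),
      sub_right_comm A (φ i)]
    rw [show A - φ j + φ i = A + φ i - φ j by abel]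
    ring
  | trans _ _ ih1 ih2 => rw [ih1, ih2]

/-! ### Maximal inequality uniform over all scales. -/

/-- Concavity of the square root: one fair step changes the squared drawdown `D ^ 2` of a walk to at
most `D ^ 2 + 1` on average. -/
lemma half_add_sqrt_le {D k : ℝ} (hk : 0 ≤ k) {a b : ℝ} (ha : a ^ 2 ≤ (D - 1) ^ 2)
    (hb : b ^ 2 ≤ (D + 1) ^ 2) :
    (√(a ^ 2 + k) + √(b ^ 2 + k)) / 2 ≤ √(D ^ 2 + (k + 1)) := by
  apply Real.le_sqrt_of_sq_le
  have h1 := Real.sq_sqrt (show 0 ≤ a ^ 2 + k by positivity)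
  have h2 := Real.sq_sqrt (show 0 ≤ b ^ 2 + k by positivity)
  nlinarith [sq_nonneg (√(a ^ 2 + k) - √(b ^ 2 + k))]

/-- A maximal inequality for the partial sums of signs, in the form of a bound for signed sums
with decreasing coefficients. -/
lemma signedMax_le_of_pairwise (φ : ι → T → ℝ) {K : ℝ} (hK : 0 ≤ K) (hφ : ∀ i t, 0 ≤ φ i t)
    (l : List ι) (hl : l.Pairwise fun i j => ∀ t, φ j t ≤ φ i t) (A a : T → ℝ) (M S : ℝ)
    (hSM : S ≤ M) (ha : ∀ t, 0 ≤ a t) (haK : ∀ t, a t ≤ K) (hal : ∀ i ∈ l, ∀ t, φ i t ≤ a t)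
    (hA : ∀ t, A t ≤ K * M - a t * (M - S)) :
    signedMax φ A l ≤ K * (S + √((M - S) ^ 2 + l.length)) := by
  -- Here `S` is the current sum of signs, `M` a bound for its running maximum and `a` the last
  -- coefficient. `hA` is Abel summation: with decreasing coefficients bounded by `K`, the weighted
  -- sum is at most `K * M` minus `a` times the drawdown `M - S`.
  induction l generalizing A a M S with
  | nil =>
    refine maxOver_le fun t => (hA t).trans ?_
    have := mul_nonneg (ha t) (sub_nonneg.2 hSM)
    simp [Real.sqrt_sq (sub_nonneg.2 hSM), this]
  | cons i l ih =>
    rw [List.pairwise_cons] at hl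
    have key : ∀ (e : ℝ) (A' : T → ℝ), (∀ t, A' t = A t + e * φ i t) →
        signedMax φ A' l ≤ K * (S + e + √((max M (S + e) - (S + e)) ^ 2 + l.length)) := by
      intro e A' hA'
      refine ih hl.2 _ (φ i) _ _ (le_max_right _ _) (hφ i)
        (fun t => (hal i (by simp) t).trans (haK t)) (fun j hj t => hl.1 j hj t) fun t => ?_
      have h1 := hA t
      have h2 := hal i (by simp) t
      have h3 := haK t
      rw [hA']
      have h4 : φ i t * (M - S) ≤ a t * (M - S) :=
        mul_le_mul_of_nonneg_right h2 (sub_nonneg.2 hSM)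
      have h5 : (K - φ i t) * M ≤ (K - φ i t) * max M (S + e) :=
        mul_le_mul_of_nonneg_left (le_max_left _ _) (by linarith)
      nlinarith
    have h1 := key 1 (A + φ i) (fun t => by simp)
    have h2 := key (-1) (A - φ i) (fun t => by simp [sub_eq_add_neg])
    -- An up-step sends the drawdown `D` to `max (D - 1) 0`, a down-step to `D + 1`.
    have ha : (max M (S + 1) - (S + 1)) ^ 2 ≤ (M - S - 1) ^ 2 := by
      rcases max_cases M (S + 1) with ⟨h, _⟩ | ⟨h, _⟩ <;> rw [h] <;> nlinarith
    have hb : (max M (S + -1) - (S + -1)) ^ 2 ≤ (M - S + 1) ^ 2 := by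
      rw [max_eq_left (by linarith)]; nlinarith
    have h3 := half_add_sqrt_le (Nat.cast_nonneg (α := ℝ) l.length) ha hb
    have h4 := mul_le_mul_of_nonneg_left h3 hK
    simp only [signedMax, List.length_cons, Nat.cast_succ]
    nlinarith

/-- Truncation of a real number to the interval `[-K, K]`. -/
def clip (K r : ℝ) : ℝ := max (-K) (min K r)

lemma abs_clip {K : ℝ} (hK : 0 ≤ K) (r : ℝ) : |clip K r| = min K |r| := by
  unfold clip
  rcases abs_cases r with ⟨h, _⟩ | ⟨h, _⟩ <;> rw [h]
  · rw [max_eq_right (by have : 0 ≤ min K r := le_min hK ‹_›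
                         linarith), abs_of_nonneg (le_min hK ‹_›)]
  · rw [min_eq_right (by linarith : r ≤ K), abs_of_nonpos (max_le (by linarith) (by linarith)),
      max_def, min_def]
    split_ifs <;> linarith

lemma clip_mono {K r s : ℝ} (h : r ≤ s) : clip K r ≤ clip K s :=
  max_le_max le_rfl (min_le_min le_rfl h)

lemma clip_eq_of_abs_le {K r : ℝ} (h : |r| ≤ K) : clip K r = r := by
  rw [abs_le] at h
  rw [clip, min_eq_right h.2, max_eq_right h.1]

lemma abs_clip_le {K : ℝ} (hK : 0 ≤ K) (r : ℝ) : |clip K r| ≤ K := by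
  rw [abs_clip hK]; exact min_le_left _ _

lemma clip_nonneg {K r : ℝ} (hK : 0 ≤ K) (hr : 0 ≤ r) : 0 ≤ clip K r :=
  (le_min hK hr).trans (le_max_right _ _)

lemma clip_nonpos {K r : ℝ} (hK : 0 ≤ K) (hr : r ≤ 0) : clip K r ≤ 0 :=
  max_le (by linarith) ((min_le_right _ _).trans hr)

lemma abs_clip_mul_sub {K : ℝ} (hK : 0 ≤ K) (b : ℝ) {q q' : ℝ} (hq : 0 ≤ q) (hq' : 0 ≤ q') :
    |clip K (q * b) - clip K (q' * b)| = |min K (q * |b|) - min K (q' * |b|)| := by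
  have e1 : min K (q * |b|) = |clip K (q * b)| := by rw [abs_clip hK, abs_mul, abs_of_nonneg hq]
  have e2 : min K (q' * |b|) = |clip K (q' * b)| := by
    rw [abs_clip hK, abs_mul, abs_of_nonneg hq']
  rw [e1, e2]
  rcases le_total 0 b with hb | hb
  · rw [abs_of_nonneg (clip_nonneg hK (mul_nonneg hq hb)),
      abs_of_nonneg (clip_nonneg hK (mul_nonneg hq' hb))]
  · rw [abs_of_nonpos (clip_nonpos hK (mul_nonpos_of_nonneg_of_nonpos hq hb)),
      abs_of_nonpos (clip_nonpos hK (mul_nonpos_of_nonneg_of_nonpos hq' hb)),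
      ← neg_sub', abs_neg]

/-- The average maximum over all scales `q` of signed sums of truncated multiples `q b_i`. -/
lemma signedMax_clip_le (b : ι → ℝ) (q : T → ℝ) (hq : ∀ t, 0 ≤ q t) {K : ℝ} (hK : 0 ≤ K)
    (l : List ι) : signedMax (fun i t => clip K (q t * b i)) 0 l ≤ K * √l.length := by
  classical
  -- The signs of the `b i` can be dropped. Sorting by `|b i|` then makes the truncated coefficients
  -- decrease in `i` simultaneously for every scale.
  refine (signedMax_contraction (f := fun i t => min K (q t * |b i|))
    (fun i s t => (abs_clip_mul_sub hK (b i) (hq s) (hq t)).le) l 0).trans ?_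
  set r : ι → ι → Prop := fun i j => |b j| ≤ |b i|
  have : DecidableRel r := Classical.decRel r
  have : IsTrans ι r := ⟨fun a b c h1 h2 => le_trans h2 h1⟩
  have : Std.Total r := ⟨fun a b => le_total _ _⟩
  rw [← signedMax_perm _ (List.perm_insertionSort r l)]
  have := signedMax_le_of_pairwise (fun i t => min K (q t * |b i|)) hK
    (fun i t => le_min hK (mul_nonneg (hq t) (abs_nonneg _))) (l.insertionSort r)
    ((List.pairwise_insertionSort r l).imp fun h t =>
      min_le_min le_rfl (mul_le_mul_of_nonneg_left h (hq t)))
    0 (fun _ => K) 0 0 le_rfl (fun _ => hK) (fun _ => le_rfl) (fun i _ t => min_le_left _ _)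
    (by simp)
  simpa using this

/-! ### The linear class and the censored loss. -/

lemma half_log_add_log_le {a b : ℝ} (ha : 0 < a) (hb : 0 < b) :
    (Real.log a + Real.log b) / 2 ≤ Real.log ((a + b) / 2) := by
  have h : Real.log (((a + b) / 2) ^ 2) = 2 * Real.log ((a + b) / 2) := by
    rw [Real.log_pow, Nat.cast_two]
  rw [div_le_iff₀ two_pos, ← Real.log_mul ha.ne' hb.ne', mul_comm _ (2 : ℝ), ← h]
  apply Real.log_le_log (by positivity)
  nlinarith [sq_nonneg (a - b)]

/-- A linear form over the ℓ¹ ball is at most the largest `|a j|`, which the log-sum-cosh soft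
maximum dominates. -/
lemma sum_mul_le_log_sum_cosh {p : ℕ} (hp : 0 < p) {θ a : Fin p → ℝ} (hθ : ∑ j, |θ j| ≤ 1) {s : ℝ}
    (hs : 0 < s) : ∑ j, θ j * a j ≤ Real.log (∑ j, 2 * Real.cosh (s * a j)) / s := by
  have hle : ∀ j, |a j| ≤ Real.log (∑ j, 2 * Real.cosh (s * a j)) / s := by
    intro j
    rw [le_div_iff₀ hs, Real.le_log_iff_exp_le
      (Finset.sum_pos (fun j _ => by have := Real.cosh_pos (s * a j); positivity)
        ⟨j, Finset.mem_univ j⟩)]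
    refine le_trans ?_ (Finset.single_le_sum (f := fun j => 2 * Real.cosh (s * a j))
      (fun j _ => by have := Real.cosh_pos (s * a j); positivity) (Finset.mem_univ j))
    rw [Real.cosh_eq, mul_comm]
    have h1 := Real.exp_pos (s * a j)
    have h2 := Real.exp_pos (-(s * a j))
    rcases abs_cases (a j) with ⟨h, _⟩ | ⟨h, _⟩ <;> rw [h]
    · linarith
    · rw [mul_neg]; linarith
  have h0 : 0 ≤ Real.log (∑ j, 2 * Real.cosh (s * a j)) / s := (abs_nonneg _).trans (hle ⟨0, hp⟩)
  calc ∑ j, θ j * a j ≤ ∑ j, |θ j| * (Real.log (∑ j, 2 * Real.cosh (s * a j)) / s) := by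
        refine Finset.sum_le_sum fun j _ => ?_
        calc θ j * a j ≤ |θ j| * |a j| := by rw [← abs_mul]; exact le_abs_self _
          _ ≤ _ := mul_le_mul_of_nonneg_left (hle j) (abs_nonneg _)
    _ ≤ _ := by
        rw [← Finset.sum_mul]
        exact mul_le_of_le_one_left h0 hθ

/-- The soft maximum serves as potential: averaging over a sign multiplies each `cosh` term by `cosh
(s * X i j) ≤ exp (s ^ 2 * K ^ 2 / 2)`, after concavity of `log` moves the average inside. -/
lemma signedMax_linear_le_log {p : ℕ} (hp : 0 < p) (X : ι → Fin p → ℝ) {K : ℝ}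
    (hX : ∀ i j, |X i j| ≤ K) (θ : T → Fin p → ℝ) (hθ : ∀ t, ∑ j, |θ t j| ≤ 1) {s : ℝ} (hs : 0 < s)
    (l : List ι) (A : T → ℝ) (a : Fin p → ℝ) (hA : ∀ t, A t ≤ ∑ j, θ t j * a j) :
    signedMax (fun i t => ∑ j, θ t j * X i j) A l ≤
      Real.log (∑ j, 2 * Real.cosh (s * a j)) / s + s * K ^ 2 / 2 * l.length := by
  induction l generalizing A a with
  | nil =>
    refine maxOver_le fun t => (hA t).trans ?_
    simpa using sum_mul_le_log_sum_cosh hp (hθ t) hs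
  | cons i l ih =>
    have h1 := ih (A + fun t => ∑ j, θ t j * X i j) (a + X i) (fun t => by
      simp only [Pi.add_apply, mul_add, Finset.sum_add_distrib]; linarith [hA t])
    have h2 := ih (A - fun t => ∑ j, θ t j * X i j) (a - X i) (fun t => by
      simp only [Pi.sub_apply, mul_sub, Finset.sum_sub_distrib]; linarith [hA t])
    have hpos : ∀ b : Fin p → ℝ, 0 < ∑ j, 2 * Real.cosh (s * b j) := fun b =>
      Finset.sum_pos (fun j _ => by have := Real.cosh_pos (s * b j); positivity)
        ⟨⟨0, hp⟩, Finset.mem_univ _⟩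
    have h3 : (Real.log (∑ j, 2 * Real.cosh (s * (a + X i) j)) +
        Real.log (∑ j, 2 * Real.cosh (s * (a - X i) j))) / 2 ≤
        Real.log (∑ j, 2 * Real.cosh (s * a j)) + s ^ 2 * K ^ 2 / 2 := by
      refine (half_log_add_log_le (hpos _) (hpos _)).trans ?_
      rw [← Real.log_exp (s ^ 2 * K ^ 2 / 2), ← Real.log_mul (hpos _).ne' (Real.exp_pos _).ne']
      apply Real.log_le_log (by have := hpos (a + X i); have := hpos (a - X i); positivity)
      rw [← Finset.sum_add_distrib, Finset.sum_div, Finset.sum_mul]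
      refine Finset.sum_le_sum fun j _ => ?_
      simp only [Pi.add_apply, Pi.sub_apply, mul_add, mul_sub, Real.cosh_add, Real.cosh_sub]
      have h4 : Real.cosh (s * X i j) ≤ Real.exp (s ^ 2 * K ^ 2 / 2) := by
        refine (Real.cosh_le_exp_half_sq _).trans (Real.exp_le_exp.2 ?_)
        have := sq_le_sq' (abs_le.1 (hX i j)).1 (abs_le.1 (hX i j)).2
        rw [mul_pow]
        nlinarith [sq_nonneg s]
      have := mul_le_mul_of_nonneg_left h4 (Real.cosh_pos (s * a j)).le
      linarith
    have h5 := div_le_div_of_nonneg_right h3 hs.le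
    have h6 : (Real.log (∑ j, 2 * Real.cosh (s * a j)) + s ^ 2 * K ^ 2 / 2) / s =
        Real.log (∑ j, 2 * Real.cosh (s * a j)) / s + s * K ^ 2 / 2 := by
      field_simp
    rw [h6, div_right_comm, add_div] at h5
    simp only [signedMax, List.length_cons, Nat.cast_succ]
    linarith

lemma signedMax_linear_le {p : ℕ} (hp : 0 < p) (X : ι → Fin p → ℝ) {K : ℝ} (hK : 0 < K)
    (hX : ∀ i j, |X i j| ≤ K) (θ : T → Fin p → ℝ) (hθ : ∀ t, ∑ j, |θ t j| ≤ 1) (l : List ι)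
    (hl : 0 < l.length) :
    signedMax (fun i t => ∑ j, θ t j * X i j) 0 l ≤ K * (√(2 * Real.log (2 * p)) * √l.length) := by
  have hlog : 0 < Real.log (2 * p) := Real.log_pos (by
    have : (1 : ℝ) ≤ p := by exact_mod_cast hp
    linarith)
  have hn : (0 : ℝ) < l.length := by exact_mod_cast hl
  have hx := Real.sqrt_pos.2 (mul_pos two_pos hlog)
  have hy := Real.sqrt_pos.2 hn
  have hx2 := Real.sq_sqrt (mul_pos two_pos hlog).le
  have hy2 := Real.sq_sqrt hn.le
  set x := √(2 * Real.log (2 * p))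
  set y := √(l.length : ℝ)
  -- This `s` balances `log (2p) / s` against `s * K ^ 2 * n / 2`, where `n` is the list length.
  have := signedMax_linear_le_log hp X hX θ hθ (s := x / (K * y)) (by positivity) l 0 0 (by simp)
  refine this.trans (le_of_eq ?_)
  have e : Real.log (∑ j : Fin p, 2 * Real.cosh (x / (K * y) * (0 : Fin p → ℝ) j)) = x ^ 2 / 2 := by
    simp only [Pi.zero_apply, mul_zero, Real.cosh_zero, mul_one, Finset.sum_const, Finset.card_univ,
      Fintype.card_fin, nsmul_eq_mul]
    rw [hx2, mul_comm (p : ℝ)]; ring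
  rw [e, ← hy2]
  field_simp
  ring

lemma max_eq_half (a b : ℝ) : max a b = (a + b) / 2 + |a - b| / 2 := by
  rcases max_cases a b with ⟨h, _⟩ | ⟨h, _⟩ <;>
    rcases abs_cases (a - b) with ⟨h', _⟩ | ⟨h', _⟩ <;> rw [h, h'] <;> linarith

/-- Write the maximum as half the sum plus half the absolute difference; contraction removes the
absolute value. -/
lemma signedMax_max_le (φ ψ : ι → T → ℝ) (l : List ι) :
    signedMax (fun i t => max (φ i t) (ψ i t)) 0 l ≤ signedMax φ 0 l + signedMax ψ 0 l := by
  have e : (fun i t => max (φ i t) (ψ i t)) =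
      fun i => (fun i => (2⁻¹ : ℝ) • (fun i => φ i + ψ i) i) i +
        (fun i t => |φ i t - ψ i t| / 2) i := by
    ext i t
    simp only [Pi.add_apply, Pi.smul_apply, smul_eq_mul]
    rw [max_eq_half]; ring
  rw [e]
  refine (signedMax_zero_add_le _ _ l).trans ?_
  have h1 := signedMax_smul_le (fun i => φ i + ψ i) (show (0 : ℝ) ≤ 2⁻¹ by norm_num) l 0
  have h2 := signedMax_contraction (φ := fun i t => |φ i t - ψ i t| / 2)
    (f := fun i => (2⁻¹ : ℝ) • (fun i => φ i + (fun i => -ψ i) i) i) (fun i s t => by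
      simp only [Pi.smul_apply, Pi.add_apply, Pi.neg_apply, smul_eq_mul]
      rw [← sub_div, ← mul_sub, abs_div, abs_mul, abs_two, abs_of_nonneg (show (0 : ℝ) ≤ 2⁻¹ by norm_num)]
      have := abs_abs_sub_abs_le (φ i s - ψ i s) (φ i t - ψ i t)
      simp only [← sub_eq_add_neg]
      linarith) l 0
  have h3 := signedMax_smul_le (fun i => φ i + (fun i => -ψ i) i) (show (0 : ℝ) ≤ 2⁻¹ by norm_num)
    l 0
  have h4 := signedMax_zero_add_le φ ψ l
  have h5 := signedMax_zero_add_le φ (fun i => -ψ i) l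
  have h6 := signedMax_contraction (φ := fun i => -ψ i) (f := ψ) (fun i s t => by
    simp only [Pi.neg_apply]; rw [← neg_sub', abs_neg]) l 0
  simp only [smul_zero] at h1 h3
  linarith

/-- Lets the baseline loss split into `|Y|` and `max C 0`, each a contraction of a single truncated
multiple. -/
lemma abs_sub_max_zero {C Y : ℝ} (h : C ≤ Y) : |Y - max C 0| = |Y| - max C 0 := by
  rcases max_cases C 0 with ⟨h1, h2⟩ | ⟨h1, h2⟩ <;> rw [h1]
  · rw [abs_of_nonneg (by linarith), abs_of_nonneg (by linarith)]
  · simp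

/-- The loss increments of the censored model, rescaled and truncated, have signed maxima
controlled uniformly in the scale. -/
lemma signedMax_censored_le {p : ℕ} (hp : 0 < p) (X : ι → Fin p → ℝ) {K : ℝ} (hK : 0 < K)
    (hX : ∀ i j, |X i j| ≤ K) (θ : T → Fin p → ℝ) (hθ : ∀ t, ∑ j, |θ t j| ≤ 1) (q : T → ℝ)
    (hq : ∀ t, 0 ≤ q t) (y c : ι → ℝ) (hcy : ∀ i, c i ≤ y i) (l : List ι) (hl : 0 < l.length) :
    signedMax (fun i t => |clip K (q t * y i) - max (clip K (q t * c i)) (∑ j, θ t j * X i j)| -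
        |clip K (q t * y i) - max (clip K (q t * c i)) 0|) 0 l ≤
      K * ((√(2 * Real.log (2 * p)) + 4) * √l.length) := by
  set Y : ι → T → ℝ := fun i t => clip K (q t * y i) with hY
  set C : ι → T → ℝ := fun i t => clip K (q t * c i) with hC
  set v : ι → T → ℝ := fun i t => ∑ j, θ t j * X i j with hv
  have e : (fun i t => |Y i t - max (C i t) (v i t)| - |Y i t - max (C i t) 0|) =
      fun i => (fun i t => |Y i t - max (C i t) (v i t)|) i +
        (fun i => (fun i t => max (C i t) 0) i + (fun i t => -|Y i t|) i) i := by
    ext i t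
    have := abs_sub_max_zero (clip_mono (K := K) (mul_le_mul_of_nonneg_left (hcy i) (hq t)))
    simp only [Pi.add_apply, hY, hC]
    rw [this]; ring
  have hYb := signedMax_clip_le y q hq hK.le l
  have hCb := signedMax_clip_le c q hq hK.le l
  have hvb := signedMax_linear_le hp X hK hX θ hθ l hl
  have h1 := signedMax_zero_add_le (fun i t => |Y i t - max (C i t) (v i t)|)
    (fun i => (fun i t => max (C i t) 0) i + (fun i t => -|Y i t|) i) l
  have h2 := signedMax_zero_add_le (fun i t => max (C i t) 0) (fun i t => -|Y i t|) l
  have h3 := signedMax_contraction (φ := fun i t => -|Y i t|) (f := Y) (fun i s t => by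
    rw [← neg_sub', abs_neg]; exact abs_abs_sub_abs_le _ _) l 0
  have h4 := signedMax_contraction (φ := fun i t => max (C i t) 0) (f := C) (fun i s t =>
    abs_max_sub_max_le_abs _ _ _) l 0
  have h5 := signedMax_contraction (φ := fun i t => |Y i t - max (C i t) (v i t)|)
    (f := fun i => Y i + (fun i t => -max (C i t) (v i t)) i) (fun i s t => by
      simp only [Pi.add_apply, ← sub_eq_add_neg]; exact abs_abs_sub_abs_le _ _) l 0
  have h6 := signedMax_zero_add_le Y (fun i t => -max (C i t) (v i t)) l
  have h7 := signedMax_contraction (φ := fun i t => -max (C i t) (v i t))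
    (f := fun i t => max (C i t) (v i t)) (fun i s t => by rw [← neg_sub', abs_neg]) l 0
  have h8 := signedMax_max_le C v l
  -- The total is two copies of `Y`, two of `C` and one of the linear part, which is the origin of
  -- the constant 4.
  rw [e]
  linarith

end Rademacher

/-! ### Symmetrization and concentration, one observation at a time. -/

section Symmetrization

variable {T : Type*} [Fintype T]

variable {Z : Type*} [MeasurableSpace Z] (μ : Measure Z) [IsProbabilityMeasure μ]

/-- The average of a functional over random translates of its argument. -/
def shiftMean (ξ : Z → T → ℝ) (Φ : (T → ℝ) → ℝ) (A : T → ℝ) : ℝ := ∫ w, Φ (A + ξ w) ∂μ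

variable {μ} {ξ : Z → T → ℝ} {Φ : (T → ℝ) → ℝ} {b : ℝ}

lemma integrable_shift (hΦ : LipschitzWith 1 Φ) (hξ : Measurable ξ) (hb : ∀ w, ‖ξ w‖ ≤ b)
    (A : T → ℝ) : Integrable (fun w => Φ (A + ξ w)) μ := by
  refine Integrable.of_bound (C := |Φ A| + b)
    (hΦ.continuous.measurable.comp (measurable_const.add hξ)).aestronglyMeasurable
    (Filter.Eventually.of_forall fun w => ?_)
  have h := hΦ.dist_le_mul (A + ξ w) A
  rw [NNReal.coe_one, one_mul, dist_eq_norm, dist_eq_norm, add_sub_cancel_left] at h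
  have h2 := norm_le_norm_add_norm_sub' (Φ (A + ξ w)) (Φ A)
  have := hb w
  rw [Real.norm_eq_abs (Φ A)] at h2
  linarith

lemma lipschitzWith_shiftMean (hΦ : LipschitzWith 1 Φ) (hξ : Measurable ξ) (hb : ∀ w, ‖ξ w‖ ≤ b) :
    LipschitzWith 1 (shiftMean μ ξ Φ) :=
  LipschitzWith.of_le_add fun A B => by
    have h1 := integral_mono (integrable_shift (μ := μ) hΦ hξ hb A)
      ((integrable_shift (μ := μ) hΦ hξ hb B).add (integrable_const (dist A B))) fun w => by
        have := hΦ.le_add_mul (A + ξ w) (B + ξ w)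
        simpa [dist_add_right] using this
    simp only [Pi.add_apply] at h1
    rw [integral_add (integrable_shift hΦ hξ hb B) (integrable_const _)] at h1
    simpa [shiftMean] using h1

lemma convexOn_shiftMean (hc : ConvexOn ℝ Set.univ Φ) (hΦ : LipschitzWith 1 Φ) (hξ : Measurable ξ)
    (hb : ∀ w, ‖ξ w‖ ≤ b) : ConvexOn ℝ Set.univ (shiftMean μ ξ Φ) := by
  refine ⟨convex_univ, fun A _ B _ x y hx hy hxy => ?_⟩
  have hA := integrable_shift (μ := μ) hΦ hξ hb A
  have hB := integrable_shift (μ := μ) hΦ hξ hb B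
  have h := integral_mono (integrable_shift (μ := μ) hΦ hξ hb (x • A + y • B))
    ((hA.const_mul x).add (hB.const_mul y)) fun w => by
      have := hc.2 (Set.mem_univ (A + ξ w)) (Set.mem_univ (B + ξ w)) hx hy hxy
      rwa [show x • (A + ξ w) + y • (B + ξ w) = x • A + y • B + ξ w by
        rw [smul_add, smul_add, add_add_add_comm, ← add_smul, hxy, one_smul]] at this
  simp only [Pi.add_apply] at h
  rw [integral_add (hA.const_mul x) (hB.const_mul y), integral_const_mul, integral_const_mul] at h
  exact h

variable {g : Z → T → ℝ} {K : ℝ}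

lemma integrable_of_norm_le (hg : Measurable g) (hK : ∀ w, ‖g w‖ ≤ K) : Integrable g μ :=
  Integrable.of_bound hg.aestronglyMeasurable K (Filter.Eventually.of_forall hK)

lemma norm_center_le (hK : ∀ w, ‖g w‖ ≤ K) (w : Z) : ‖(∫ v, g v ∂μ) - g w‖ ≤ K + K := by
  refine (norm_sub_le _ _).trans (add_le_add ?_ (hK w))
  simpa using norm_integral_le_of_norm_le_const (μ := μ) (Filter.Eventually.of_forall hK)

variable [Nonempty T]

lemma lipschitzWith_maxOver : LipschitzWith 1 (maxOver : (T → ℝ) → ℝ) :=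
  LipschitzWith.of_le_add fun A B => maxOver_le fun t => by
    have h1 := le_maxOver B t
    have h2 := (le_abs_self _).trans (Real.dist_eq (A t) (B t) ▸ dist_le_pi_dist A B t)
    linarith

lemma convexOn_maxOver : ConvexOn ℝ Set.univ (maxOver : (T → ℝ) → ℝ) :=
  ⟨convex_univ, fun A _ B _ _ _ ha hb _ => maxOver_le fun t =>
    add_le_add (mul_le_mul_of_nonneg_left (le_maxOver A t) ha)
      (mul_le_mul_of_nonneg_left (le_maxOver B t) hb)⟩

variable (μ)

/-- `E max_t (A t + ∑_{i ≤ n} (E g_t - g_t(w_i)))` for i.i.d. `w_i`. -/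
def centeredMean (g : Z → T → ℝ) : ℕ → (T → ℝ) → ℝ
  | 0 => maxOver
  | n + 1 => shiftMean μ (fun w => (∫ v, g v ∂μ) - g w) (centeredMean g n)

/-- `E max_t (A t + ∑_{i ≤ n} ± φ_t(w_i))` for i.i.d. `w_i` and independent signs. -/
def signedMean (φ : Z → T → ℝ) : ℕ → (T → ℝ) → ℝ
  | 0 => maxOver
  | n + 1 => fun A => (shiftMean μ φ (signedMean φ n) A +
      shiftMean μ (fun w => -φ w) (signedMean φ n) A) / 2

variable {μ}

lemma lipschitzWith_centeredMean (hg : Measurable g) (hK : ∀ w, ‖g w‖ ≤ K) (n : ℕ) :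
    LipschitzWith 1 (centeredMean μ g n) := by
  induction n with
  | zero => exact lipschitzWith_maxOver
  | succ n ih => exact lipschitzWith_shiftMean ih (hg.const_sub _) (norm_center_le hK)

lemma lipschitzWith_signedMean (hg : Measurable g) (hK : ∀ w, ‖g w‖ ≤ K) (n : ℕ) :
    LipschitzWith 1 (signedMean μ g n) := by
  induction n with
  | zero => exact lipschitzWith_maxOver
  | succ n ih =>
    refine LipschitzWith.of_le_add fun A B => ?_
    have h1 := (lipschitzWith_shiftMean (μ := μ) ih hg hK).le_add_mul A B
    have h2 := (lipschitzWith_shiftMean (μ := μ) ih hg.neg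
      (fun w => (norm_neg (g w)).trans_le (hK w))).le_add_mul A B
    rw [NNReal.coe_one, one_mul] at h1 h2
    change (shiftMean μ g (signedMean μ g n) A + shiftMean μ (-g) (signedMean μ g n) A) / 2 ≤
      (shiftMean μ g (signedMean μ g n) B + shiftMean μ (-g) (signedMean μ g n) B) / 2 + dist A B
    linarith

lemma convexOn_signedMean (hg : Measurable g) (hK : ∀ w, ‖g w‖ ≤ K) (n : ℕ) :
    ConvexOn ℝ Set.univ (signedMean μ g n) := by
  induction n with
  | zero => exact convexOn_maxOver
  | succ n ih =>
    have hL := lipschitzWith_signedMean (μ := μ) hg hK n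
    have h1 := convexOn_shiftMean (μ := μ) ih hL hg hK
    have h2 := convexOn_shiftMean (μ := μ) (ξ := fun w => -g w) ih hL hg.neg
      (fun w => (norm_neg (g w)).trans_le (hK w))
    have := (h1.add h2).smul (show (0 : ℝ) ≤ 2⁻¹ by norm_num)
    refine this.congr fun A _ => ?_
    simp only [signedMean, Pi.add_apply, smul_eq_mul]
    ring

/-- Symmetrization. -/
lemma centeredMean_le_signedMean (hg : Measurable g) (hK : ∀ w, ‖g w‖ ≤ K) (n : ℕ) (A : T → ℝ) :
    centeredMean μ g n A ≤ signedMean μ (fun w => (2 : ℝ) • g w) n A := by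
  induction n generalizing A with
  | zero => exact le_rfl
  | succ n ih =>
    have hg2 : Measurable fun w => (2 : ℝ) • g w := hg.const_smul (2 : ℝ)
    have hK2 : ∀ w, ‖(2 : ℝ) • g w‖ ≤ 2 * K := fun w => by
      rw [norm_smul, Real.norm_two]; linarith [hK w]
    have hK2' : ∀ w, ‖-((2 : ℝ) • g w)‖ ≤ 2 * K := fun w => (norm_neg _).trans_le (hK2 w)
    set W := signedMean μ (fun w => (2 : ℝ) • g w) n with hW
    have hL : LipschitzWith 1 W := lipschitzWith_signedMean hg2 hK2 n
    have hc : ConvexOn ℝ Set.univ W := convexOn_signedMean hg2 hK2 n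
    have hplus := integrable_shift (μ := μ) hL hg2 hK2 A
    have hminus : Integrable (fun w => W (A + -((2 : ℝ) • g w))) μ :=
      integrable_shift hL hg2.neg hK2' A
    have hjensen : W (A + (2 : ℝ) • ∫ v, g v ∂μ) ≤ ∫ w, W (A + (2 : ℝ) • g w) ∂μ := by
      have h := hc.map_integral_le (μ := μ) (f := fun w => A + (2 : ℝ) • g w)
        hL.continuous.continuousOn isClosed_univ (by simp)
        ((integrable_const A).add (integrable_of_norm_le hg2 hK2)) hplus
      rwa [integral_add (integrable_const A) (integrable_of_norm_le hg2 hK2), integral_smul,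
        integral_const, probReal_univ, one_smul] at h
    calc centeredMean μ g (n + 1) A = ∫ w, centeredMean μ g n (A + ((∫ v, g v ∂μ) - g w)) ∂μ := rfl
      _ ≤ ∫ w, (W (A + (2 : ℝ) • ∫ v, g v ∂μ) / 2 + W (A + -((2 : ℝ) • g w)) / 2) ∂μ := by
        refine integral_mono (integrable_shift (lipschitzWith_centeredMean hg hK n)
          (hg.const_sub _) (norm_center_le hK) A)
          ((integrable_const _).add (hminus.div_const 2)) fun w => (ih _).trans ?_
        -- No ghost sample: `E g - g w` is the midpoint of `2 E g` and `-2 g w`. Convexity separates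
        -- the two, and Jensen replaces `2 E g` by the mean over `2 g w`.
        have := hc.2 (Set.mem_univ (A + (2 : ℝ) • ∫ v, g v ∂μ))
          (Set.mem_univ (A + -((2 : ℝ) • g w))) (show (0 : ℝ) ≤ 2⁻¹ by norm_num)
          (show (0 : ℝ) ≤ 2⁻¹ by norm_num) (by norm_num)
        rw [show (2⁻¹ : ℝ) • (A + (2 : ℝ) • ∫ v, g v ∂μ) + (2⁻¹ : ℝ) • (A + -((2 : ℝ) • g w)) =
          A + ((∫ v, g v ∂μ) - g w) by ext t; simp; ring] at this
        simp only [smul_eq_mul] at this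
        linarith
      _ = W (A + (2 : ℝ) • ∫ v, g v ∂μ) / 2 + (∫ w, W (A + -((2 : ℝ) • g w)) ∂μ) / 2 := by
        rw [integral_add (integrable_const _) (hminus.div_const 2), integral_const,
          probReal_univ, one_smul, integral_div]
      _ ≤ signedMean μ (fun w => (2 : ℝ) • g w) (n + 1) A := by
        simp only [signedMean, shiftMean, ← hW]
        linarith

/-- Passes from a bound for every fixed sample to a bound for the mean. A list of starting points is
needed because each new observation replaces `A` by both `A + g w` and `A - g w`, whose values are
bounded only on average. -/
lemma sum_signedMean_le (hg : Measurable g) (hK : ∀ w, ‖g w‖ ≤ K) (n : ℕ) (L : List (T → ℝ)) (b : ℝ)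
    (hL : ∀ l : List Z, l.length = n → (L.map fun A => signedMax g A l).sum ≤ b) :
    (L.map fun A => signedMean μ g n A).sum ≤ b := by
  induction n generalizing L b with
  | zero => exact hL [] rfl
  | succ n ih =>
    have hi := fun A => integrable_shift (μ := μ) (lipschitzWith_signedMean (μ := μ) hg hK n) hg hK A
    have hi' := fun A => integrable_shift (μ := μ) (ξ := fun w => -g w)
      (lipschitzWith_signedMean (μ := μ) hg hK n) hg.neg
      (fun w => (norm_neg (g w)).trans_le (hK w)) A
    set f : (T → ℝ) → Z → ℝ := fun A w =>
      (signedMean μ g n (A + g w) + signedMean μ g n (A + -g w)) / 2 with hf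
    have hfi : ∀ A, Integrable (f A) μ := fun A => ((hi A).add (hi' A)).div_const 2
    have hfI : ∀ A, signedMean μ g (n + 1) A = ∫ w, f A w ∂μ := fun A => by
      simp only [signedMean, shiftMean, hf]
      rw [integral_div, integral_add (hi A) (hi' A)]
    have hsum : ∀ L : List (T → ℝ), Integrable (fun w => (L.map fun A => f A w).sum) μ ∧
        (L.map fun A => signedMean μ g (n + 1) A).sum = ∫ w, (L.map fun A => f A w).sum ∂μ := by
      intro L
      induction L with
      | nil => simp
      | cons A L ihL =>
        simp only [List.map_cons, List.sum_cons]
        exact ⟨(hfi A).add ihL.1, by rw [integral_add (hfi A) ihL.1, ihL.2, hfI]⟩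
    have hpt : ∀ w, (L.map fun A => f A w).sum ≤ b := by
      intro w
      have e : ∀ (F : (T → ℝ) → ℝ) (L : List (T → ℝ)),
          ((L.flatMap fun A => [A + g w, A - g w]).map F).sum =
            2 * (L.map fun A => (F (A + g w) + F (A - g w)) / 2).sum := by
        intro F L
        induction L with
        | nil => simp
        | cons A L ihL =>
          simp only [List.flatMap_cons, List.map_append, List.sum_append, ihL, List.map_cons,
            List.sum_cons, List.map_nil, List.sum_nil]
          ring
      have h := ih (L.flatMap fun A => [A + g w, A - g w]) (2 * b) fun l hl => by
        rw [e]
        have := hL (w :: l) (by simp [hl])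
        simp only [signedMax] at this
        linarith
      rw [e] at h
      simp only [hf, ← sub_eq_add_neg]
      linarith
    rw [(hsum L).2]
    simpa using integral_mono (hsum L).1 (integrable_const b) hpt

/-- A bounded differences inequality for exponential moments. -/
lemma lintegral_exp_maxOver_le (hg : Measurable g) (hK : ∀ w, ‖g w‖ ≤ K) (s : ℝ) (n : ℕ)
    (A : T → ℝ) :
    ∫⁻ w, ENNReal.ofReal (Real.exp (s * maxOver (A + ∑ i, ((∫ v, g v ∂μ) - g (w i)))))
      ∂(Measure.pi fun _ : Fin n => μ) ≤
      ENNReal.ofReal (Real.exp (s * centeredMean μ g n A + n * (s ^ 2 * K ^ 2 / 2))) := by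
  induction n generalizing A with
  | zero => simp [centeredMean]
  | succ n ih =>
    set m := ∫ v, g v ∂μ with hm
    have hL := lipschitzWith_centeredMean (μ := μ) hg hK n
    set X : Z → ℝ := fun w => centeredMean μ g n (A + (m - g w)) with hX
    have hXm : Measurable X :=
      hL.continuous.measurable.comp ((hg.const_sub m).const_add A)
    have hXI : ∫ w, X w ∂μ = centeredMean μ g (n + 1) A := rfl
    have hmeas : Measurable fun w : Fin (n + 1) → Z =>
        ENNReal.ofReal (Real.exp (s * maxOver (A + ∑ i, (m - g (w i))))) := by
      have h0 : Measurable (maxOver : (T → ℝ) → ℝ) := lipschitzWith_maxOver.continuous.measurable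
      refine (Real.measurable_exp.comp ((h0.comp (Measurable.const_add ?_ A)).const_mul s)).ennreal_ofReal
      exact Finset.measurable_fun_sum _ fun i _ => (hg.comp (measurable_pi_apply i)).const_sub m
    have hp := (measurePreserving_piFinSuccAbove (fun _ : Fin (n + 1) => μ) 0).symm
    rw [← hp.lintegral_comp hmeas]
    refine (lintegral_prod _ (hmeas.comp hp.measurable).aemeasurable).trans_le ?_
    -- The conditional mean is 1-Lipschitz in its shift, so as a function of the next observation it
    -- stays within `K` of its value at `A + m`; Hoeffding's lemma gives variance proxy `K ^ 2`.
    have hsub : HasSubgaussianMGF (fun w => X w - ∫ v, X v ∂μ) _ μ := hasSubgaussianMGF_of_mem_Icc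
      (a := centeredMean μ g n (A + m) - K) (b := centeredMean μ g n (A + m) + K) hXm.aemeasurable
      (Filter.Eventually.of_forall fun w => by
        have h1 := hL.dist_le_mul (A + (m - g w)) (A + m)
        have h2 := hK w
        rw [NNReal.coe_one, one_mul, Real.dist_eq, dist_eq_norm,
          show A + (m - g w) - (A + m) = -g w by abel, norm_neg] at h1
        have h3 := abs_le.1 (h1.trans h2)
        constructor <;> simp only [hX] <;> linarith [h3.1, h3.2])
    have hint := hsub.integrable_exp_mul s
    have hmgf := hsub.mgf_le s
    have hKK : (((‖centeredMean μ g n (A + m) + K - (centeredMean μ g n (A + m) - K)‖₊ / 2) ^ 2 :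
        ℝ≥0) : ℝ) = K ^ 2 := by
      rw [NNReal.coe_pow, NNReal.coe_div, coe_nnnorm,
        show centeredMean μ g n (A + m) + K - (centeredMean μ g n (A + m) - K) = 2 * K by ring,
        norm_mul, Real.norm_two, NNReal.coe_two, mul_div_cancel_left₀ _ two_ne_zero,
        Real.norm_eq_abs, sq_abs]
    rw [hKK, hXI, mgf] at hmgf
    rw [hXI] at hint
    calc _ ≤ ∫⁻ w, ENNReal.ofReal (Real.exp (s * X w + n * (s ^ 2 * K ^ 2 / 2))) ∂μ := by
          refine lintegral_mono fun w => (le_of_eq ?_).trans (ih (A + (m - g w)))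
          refine lintegral_congr fun w' => ?_
          simp only [Function.comp_apply, MeasurableEquiv.piFinSuccAbove_symm_apply,
            Fin.insertNthEquiv, Equiv.coe_fn_mk, Fin.sum_univ_succ, Fin.insertNth_zero,
            Fin.cons_zero, Fin.cons_succ, add_assoc, hm]
          rfl
      _ = ∫⁻ w, ENNReal.ofReal (Real.exp (s * centeredMean μ g (n + 1) A +
            n * (s ^ 2 * K ^ 2 / 2)) *
            Real.exp (s * (X w - centeredMean μ g (n + 1) A))) ∂μ := by
          refine lintegral_congr fun w => ?_
          rw [← Real.exp_add]
          congr 2; ring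
      _ = ENNReal.ofReal (∫ w, Real.exp (s * centeredMean μ g (n + 1) A +
            n * (s ^ 2 * K ^ 2 / 2)) *
            Real.exp (s * (X w - centeredMean μ g (n + 1) A)) ∂μ) :=
          (ofReal_integral_eq_lintegral_ofReal (hint.const_mul _)
            (Filter.Eventually.of_forall fun w => by positivity)).symm
      _ ≤ _ := by
          apply ENNReal.ofReal_le_ofReal
          rw [integral_const_mul]
          refine (mul_le_mul_of_nonneg_left hmgf (Real.exp_pos _).le).trans (le_of_eq ?_)
          rw [← Real.exp_add]
          congr 1; push_cast; ring

/-- A uniform deviation inequality over a finite class, given a bound for its signed maxima. -/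
lemma measure_exists_sum_ge_le (hg : Measurable g) (hK0 : 0 < K) (hK : ∀ w, ‖g w‖ ≤ K) {n : ℕ}
    (hn : 0 < n) {a r u : ℝ} (ha : ∀ l : List Z, l.length = n → signedMax g 0 l ≤ a)
    (hr : 0 ≤ r) (hu : 2 * a + r ≤ u) :
    (Measure.pi fun _ : Fin n => μ) {w | ∃ t, u ≤ ∑ i, ((∫ v, g v t ∂μ) - g (w i) t)} ≤
      ENNReal.ofReal (Real.exp (-(r ^ 2 / (2 * n * K ^ 2)))) := by
  have hn' : (0 : ℝ) < n := by exact_mod_cast hn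
  set m := ∫ v, g v ∂μ with hm
  have hmt : ∀ t, m t = ∫ v, g v t ∂μ := fun t => by
    rw [hm]
    exact eval_integral (μ := μ) (fun t => (integrable_of_norm_le hg hK).eval t) t
  set V := centeredMean μ g n 0 with hV
  have hVa : V ≤ 2 * a := by
    refine (centeredMean_le_signedMean hg hK n 0).trans ?_
    have := sum_signedMean_le (μ := μ) (g := fun w => (2 : ℝ) • g w) (K := 2 * K)
      (hg.const_smul (2 : ℝ)) (fun w => by rw [norm_smul, Real.norm_two]; linarith [hK w]) n [0]
      (2 * a) fun l hl => by
        have h1 := signedMax_smul_le g (show (0 : ℝ) ≤ 2 by norm_num) l 0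
        have h2 := ha l hl
        rw [smul_zero] at h1
        simp only [List.map_cons, List.map_nil, List.sum_cons, List.sum_nil, add_zero]
        linarith
    simpa using this
  -- The optimal Chernoff parameter for variance proxy `n * K ^ 2`.
  set s := r / (n * K ^ 2) with hs
  have hs0 : 0 ≤ s := by positivity
  set F : (Fin n → Z) → ℝ := fun w => maxOver (0 + ∑ i, (m - g (w i))) with hF
  have hmeas : Measurable fun w : Fin n → Z => ENNReal.ofReal (Real.exp (s * F w)) := by
    have h0 : Measurable (maxOver : (T → ℝ) → ℝ) := lipschitzWith_maxOver.continuous.measurable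
    refine (Real.measurable_exp.comp ((h0.comp (Measurable.const_add ?_ 0)).const_mul s)).ennreal_ofReal
    exact Finset.measurable_fun_sum _ fun i _ => (hg.comp (measurable_pi_apply i)).const_sub m
  have hsubset : {w : Fin n → Z | ∃ t, u ≤ ∑ i, ((∫ v, g v t ∂μ) - g (w i) t)} ⊆
      {w | ENNReal.ofReal (Real.exp (s * (V + r))) ≤ ENNReal.ofReal (Real.exp (s * F w))} := by
    rintro w ⟨t, ht⟩
    refine ENNReal.ofReal_le_ofReal (Real.exp_le_exp.2 (mul_le_mul_of_nonneg_left ?_ hs0))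
    have h1 := le_maxOver (0 + ∑ i, (m - g (w i))) t
    simp only [zero_add, Finset.sum_apply, Pi.sub_apply, hmt] at h1
    simp only [hF, zero_add]
    linarith
  refine (measure_mono hsubset).trans ?_
  refine (meas_ge_le_lintegral_div hmeas.aemeasurable
    (by simpa using Real.exp_pos _) ENNReal.ofReal_ne_top).trans ?_
  refine (ENNReal.div_le_div_right (lintegral_exp_maxOver_le hg hK s n 0) _).trans ?_
  rw [← ENNReal.ofReal_div_of_pos (Real.exp_pos _), ← Real.exp_sub]
  refine ENNReal.ofReal_le_ofReal (Real.exp_le_exp.2 (le_of_eq ?_))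
  rw [← hV, hs]
  field_simp
  ring

end Symmetrization

/-! ### Identification of `f₀` and the quadratic margin. -/

section Margin

/-- A slope for the two-sided linear growth of the error distribution function at its median. -/
def growthConst (K0 d : ℝ) (L : ℝ≥0) : ℝ :=
  d / 2 * (d / (2 * (L + 1)) / max K0 (d / (2 * (L + 1))))

lemma growthConst_pos (K0 : ℝ) {d : ℝ} (hd : 0 < d) (L : ℝ≥0) : 0 < growthConst K0 d L := by
  have h : 0 < d / (2 * ((L : ℝ) + 1)) := by positivity
  have h2 : 0 < max K0 (d / (2 * ((L : ℝ) + 1))) := lt_max_of_lt_right h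
  unfold growthConst
  positivity

variable {ν : Measure ℝ} {L : ℝ≥0} {d : ℝ}

/-- Within `d / (2 * (L + 1))` of `0` the Lipschitz derivative has dropped by at most `d / 2`. Using
`L + 1` keeps the radius meaningful when `L = 0`. -/
lemma ErrorCondition.mul_sub_le_cdf_sub (h : ErrorCondition ν L d) {r s : ℝ}
    (hr : -(d / (2 * (L + 1))) ≤ r) (hs : s ≤ d / (2 * (L + 1))) (hrs : r ≤ s) :
    d / 2 * (s - r) ≤ cdf ν s - cdf ν r := by
  have hdiff : Differentiable ℝ (cdf ν) := h.contDiff.differentiable one_ne_zero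
  refine (convex_Icc r s).mul_sub_le_image_sub_of_le_deriv hdiff.continuous.continuousOn
    hdiff.differentiableOn (fun x hx => ?_) r ⟨le_rfl, hrs⟩ s ⟨hrs, le_rfl⟩ hrs
  rw [interior_Icc] at hx
  have h1 := h.lipschitz.dist_le_mul x 0
  rw [h.deriv_zero, Real.dist_eq, Real.dist_eq, sub_zero] at h1
  have h2 : |x| ≤ d / (2 * (L + 1)) := abs_le.2 ⟨by linarith [hx.1], by linarith [hx.2]⟩
  have h3 : (L : ℝ) * |x| ≤ d / 2 := by
    calc (L : ℝ) * |x| ≤ (L + 1) * (d / (2 * (L + 1))) := by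
          apply mul_le_mul _ h2 (abs_nonneg _) (by positivity); linarith
      _ = d / 2 := by field_simp
  linarith [(abs_le.1 (h1.trans h3)).1]

variable {p : ℕ} {β0 : Fin p → ℝ} {z : (Fin p → ℝ) × ℝ}

variable {Q : Measure ((Fin p → ℝ) × ℝ)}

lemma BoundedDesign.abs_dotProduct_le {KX : ℝ} (hX : BoundedDesign Q KX) :
    ∀ᵐ z ∂Q, ∀ δ : Fin p → ℝ, |z.1 ⬝ᵥ δ| ≤ KX * l1Norm δ := by
  filter_upwards [ae_all_iff.2 hX] with z hz δ
  unfold dotProduct l1Norm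
  rw [Finset.mul_sum]
  refine (Finset.abs_sum_le_sum_abs _ _).trans (Finset.sum_le_sum fun j _ => ?_)
  rw [abs_mul]
  exact mul_le_mul_of_nonneg_right (hz j) (abs_nonneg _)

lemma risk_congr_ae {f f' : (Fin p → ℝ) × ℝ → ℝ} (hf : f =ᵐ[Q] f') :
    risk Q ν β0 f = risk Q ν β0 f' := by
  refine integral_congr_ae ?_
  filter_upwards [Measure.quasiMeasurePreserving_fst.ae hf] with w hw
  rw [hw]

/-- Shrinking `τ` by `τ0 / max K0 τ0` brings it into the neighbourhood where the slope bound holds;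
monotonicity of the distribution function carries the bound back to `τ`. -/
lemma ErrorCondition.le_cdf (h : ErrorCondition ν L d) {K0 τ : ℝ} (hτ : 0 ≤ τ) (hτK : τ ≤ K0) :
    growthConst K0 d L * τ ≤ cdf ν τ - 1 / 2 ∧ growthConst K0 d L * τ ≤ 1 / 2 - cdf ν (-τ) := by
  have hd := h.pos
  unfold growthConst
  have hτ0 : 0 < d / (2 * ((L : ℝ) + 1)) := by positivity
  set τ0 := d / (2 * ((L : ℝ) + 1))
  have hM : 0 < max K0 τ0 := lt_max_of_lt_right hτ0
  have h1 : τ0 / max K0 τ0 * τ ≤ τ0 := by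
    rw [div_mul_eq_mul_div, div_le_iff₀ hM]
    exact mul_le_mul_of_nonneg_left (hτK.trans (le_max_left _ _)) hτ0.le
  have h2 : τ0 / max K0 τ0 * τ ≤ τ :=
    mul_le_of_le_one_left hτ ((div_le_one hM).2 (le_max_right _ _))
  have h0 : 0 ≤ τ0 / max K0 τ0 * τ := by positivity
  set σ := τ0 / max K0 τ0 * τ
  rw [mul_assoc]
  constructor
  · have h3 := h.mul_sub_le_cdf_sub (r := 0) (s := σ) (by linarith) h1 h0
    have h4 := (monotone_cdf ν) h2
    rw [h.median] at h3
    simp only [sub_zero] at h3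
    linarith
  · have h3 := h.mul_sub_le_cdf_sub (r := -σ) (s := 0) (by linarith) hτ0.le (by linarith)
    have h4 := (monotone_cdf ν) (neg_le_neg h2)
    rw [h.median] at h3
    simp only [zero_sub, neg_neg] at h3
    linarith

variable [IsProbabilityMeasure ν]

lemma integrable_abs_sub {ψ : ℝ → ℝ} (hint : Integrable ψ ν) (a : ℝ) :
    Integrable (fun e => |ψ e - a|) ν :=
  (hint.sub (integrable_const a)).abs

lemma integral_step_combination (w k r s : ℝ) :
    Integrable (fun e : ℝ => w * (k * (if e ≤ r then 1 else 0) + k * (if e ≤ s then 1 else 0) - k)) ν ∧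
      ∫ e, w * (k * (if e ≤ r then 1 else 0) + k * (if e ≤ s then 1 else 0) - k) ∂ν =
        w * (k * cdf ν r + k * cdf ν s - k) := by
  have hstep : ∀ r : ℝ, Integrable (fun e : ℝ => k * (if e ≤ r then (1 : ℝ) else 0)) ν ∧
      ∫ e, k * (if e ≤ r then (1 : ℝ) else 0) ∂ν = k * cdf ν r := by
    intro r
    have h : (fun e : ℝ => if e ≤ r then (1 : ℝ) else 0) = (Set.Iic r).indicator fun _ => 1 := by
      ext e; simp [Set.indicator_apply]
    refine ⟨?_, ?_⟩
    · have hi := ((integrable_const (μ := ν) (1 : ℝ)).indicator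
        (measurableSet_Iic (a := r))).const_mul k
      rw [← h] at hi
      exact hi
    · rw [integral_const_mul, h, integral_indicator_const _ measurableSet_Iic, cdf_eq_real,
        smul_eq_mul, mul_one]
  obtain ⟨ir, er⟩ := hstep r
  obtain ⟨is, es⟩ := hstep s
  refine ⟨((ir.add is).sub (integrable_const k)).const_mul w, ?_⟩
  have h := integral_sub (ir.add is) (integrable_const k)
  simp only [Pi.add_apply] at h
  rw [integral_const_mul, h, integral_add ir is, er, es]
  simp

lemma response_le_add {e s : ℝ} (hs : 0 ≤ s) (he : e ≤ s) :
    response β0 z e ≤ predictor β0 z + s :=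
  max_le (by have := le_max_right (z.1 ⬝ᵥ β0) z.2; unfold predictor; linarith)
    (by have := le_max_left (z.1 ⬝ᵥ β0) z.2; unfold predictor; linarith)

lemma le_response_add {e s : ℝ} (hs : 0 ≤ s) (he : -s ≤ e) :
    predictor β0 z ≤ response β0 z e + s :=
  max_le (by have := le_max_right z.2 (z.1 ⬝ᵥ β0 + e); unfold response; linarith)
    (by have := le_max_left z.2 (z.1 ⬝ᵥ β0 + e); unfold response; linarith)

/-- With `w = a - predictor β0 z`, the loss difference equals `w` when `e ≤ 0`, is nonnegative when
`0 < e ≤ s` since `y` then lies below the midpoint, and is at least `-w` otherwise. Only upper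
bounds on `y` enter, so censoring does no harm. -/
lemma condRisk_sub_ge_of_le (hint : Integrable (response β0 z) ν) {a s : ℝ}
    (ha : predictor β0 z ≤ a) (hs : 0 ≤ s) (hsa : s ≤ (a - predictor β0 z) / 2) :
    (a - predictor β0 z) * (cdf ν 0 + cdf ν s - 1) ≤
      condRisk ν β0 z a - condRisk ν β0 z (predictor β0 z) := by
  obtain ⟨hi, he⟩ := integral_step_combination (ν := ν) (a - predictor β0 z) 1 0 s
  simp only [one_mul] at hi he
  unfold condRisk
  rw [← integral_sub (integrable_abs_sub hint _) (integrable_abs_sub hint _), ← he]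
  refine integral_mono hi
    ((integrable_abs_sub hint _).sub (integrable_abs_sub hint _)) fun e => ?_
  simp only
  set y := response β0 z e with hy
  set m := predictor β0 z with hm
  by_cases h0 : e ≤ 0
  · have h1 : y ≤ m + 0 := response_le_add le_rfl h0
    rw [if_pos h0, if_pos (h0.trans hs), abs_of_nonpos (by linarith), abs_of_nonpos (by linarith)]
    linarith
  · rw [if_neg h0]
    by_cases h1 : e ≤ s
    · have h2 : y ≤ m + s := response_le_add hs h1
      rw [if_pos h1, abs_of_nonpos (by linarith)]
      rcases abs_cases (y - m) with ⟨h, _⟩ | ⟨h, _⟩ <;> rw [h] <;> linarith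
    · rw [if_neg h1]
      have := abs_sub_le y a m
      rw [abs_of_nonneg (sub_nonneg.2 ha)] at this
      linarith

lemma condRisk_sub_ge_of_ge (hint : Integrable (response β0 z) ν) {a s : ℝ}
    (ha : a ≤ predictor β0 z) (hs : 0 ≤ s) (hsa : s ≤ (predictor β0 z - a) / 2) :
    (predictor β0 z - a) * (1 - cdf ν 0 - cdf ν (-s)) ≤
      condRisk ν β0 z a - condRisk ν β0 z (predictor β0 z) := by
  obtain ⟨hi, he⟩ := integral_step_combination (ν := ν) (predictor β0 z - a) (-1) 0 (-s)
  unfold condRisk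
  rw [← integral_sub (integrable_abs_sub hint _) (integrable_abs_sub hint _),
    show 1 - cdf ν 0 - cdf ν (-s) = -1 * cdf ν 0 + -1 * cdf ν (-s) - -1 by ring, ← he]
  refine integral_mono hi
    ((integrable_abs_sub hint _).sub (integrable_abs_sub hint _)) fun e => ?_
  simp only
  set y := response β0 z e with hy
  set m := predictor β0 z with hm
  by_cases h0 : e ≤ -s
  · rw [if_pos h0, if_pos (h0.trans (by linarith))]
    have := abs_sub_le y a m
    rw [abs_sub_comm a m, abs_of_nonneg (sub_nonneg.2 ha)] at this
    linarith
  · rw [if_neg h0]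
    by_cases h1 : e ≤ 0
    · have h2 : m ≤ y + s := le_response_add hs (not_le.1 h0).le
      rw [if_pos h1, abs_of_nonneg (by linarith)]
      rcases abs_cases (y - m) with ⟨h, _⟩ | ⟨h, _⟩ <;> rw [h] <;> linarith
    · have h2 : m ≤ y + 0 := le_response_add le_rfl (by linarith)
      rw [if_neg h1, abs_of_nonneg (by linarith), abs_of_nonneg (by linarith)]
      linarith

lemma ErrorCondition.isCondMinimizer (h : ErrorCondition ν L d)
    (hint : Integrable (response β0 z) ν) : IsCondMinimizer ν β0 z (predictor β0 z) := by
  intro a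
  rcases le_total (predictor β0 z) a with ha | ha
  · have := condRisk_sub_ge_of_le hint ha le_rfl (by linarith)
    rw [h.median] at this
    linarith
  · have := condRisk_sub_ge_of_ge hint ha le_rfl (by linarith)
    rw [neg_zero, h.median] at this
    linarith

/-- The quadratic margin of the conditional risk at its minimiser. -/
lemma ErrorCondition.condRisk_margin (h : ErrorCondition ν L d)
    (hint : Integrable (response β0 z) ν) {a K0 : ℝ} (ha : |a - predictor β0 z| ≤ K0) :
    growthConst K0 d L / 2 * (a - predictor β0 z) ^ 2 ≤
      condRisk ν β0 z a - condRisk ν β0 z (predictor β0 z) := by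
  rcases le_total (predictor β0 z) a with hm | hm
  · have hw := sub_nonneg.2 hm
    rw [abs_of_nonneg hw] at ha
    -- The choice `s = (a - predictor β0 z) / 2` is the largest allowed and yields the quadratic
    -- gain; `s = 0` gives only minimality.
    have h1 := condRisk_sub_ge_of_le hint hm (div_nonneg hw zero_le_two) le_rfl
    have h2 := (h.le_cdf (div_nonneg hw zero_le_two) (by linarith : (a - predictor β0 z) / 2 ≤ K0)).1
    have h3 := mul_le_mul_of_nonneg_left h2 hw
    rw [h.median] at h1
    nlinarith
  · have hw := sub_nonneg.2 hm
    rw [abs_sub_comm, abs_of_nonneg hw] at ha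
    have h1 := condRisk_sub_ge_of_ge hint hm (div_nonneg hw zero_le_two) le_rfl
    have h2 := (h.le_cdf (div_nonneg hw zero_le_two) (by linarith : (predictor β0 z - a) / 2 ≤ K0)).2
    have h3 := mul_le_mul_of_nonneg_left h2 hw
    rw [h.median] at h1
    nlinarith

variable [IsProbabilityMeasure Q]

lemma measurable_predictor (β : Fin p → ℝ) :
    Measurable (predictor β : (Fin p → ℝ) × ℝ → ℝ) := by
  unfold predictor dotProduct
  fun_prop

lemma measurable_response (β0 : Fin p → ℝ) :
    Measurable fun w : ((Fin p → ℝ) × ℝ) × ℝ => response β0 w.1 w.2 := by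
  unfold response dotProduct
  fun_prop

lemma ErrorCondition.bestPredictor_ae_eq (h : ErrorCondition ν L d)
    (hint : Integrable (fun w : ((Fin p → ℝ) × ℝ) × ℝ => response β0 w.1 w.2) (Q.prod ν))
    (hu : UniqueBestPredictor Q ν β0) : bestPredictor ν β0 =ᵐ[Q] predictor β0 := by
  filter_upwards [hu, hint.prod_right_ae] with z hz hi
  exact hz.unique (Classical.epsilon_spec hz.exists) (h.isCondMinimizer hi)

lemma abs_predictor_sub_le (β β' : Fin p → ℝ) (z : (Fin p → ℝ) × ℝ) :
    |predictor β z - predictor β' z| ≤ |z.1 ⬝ᵥ (β - β')| := by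
  rw [dotProduct_sub]
  exact abs_max_sub_max_le_abs _ _ _

/-- Conditional minimality compares the loss at `β0` with `E[|y| | x, c]`, which is integrable;
changing `β` alters the loss by a bounded amount. -/
lemma ErrorCondition.integrable_loss (h : ErrorCondition ν L d)
    (hint : Integrable (fun w : ((Fin p → ℝ) × ℝ) × ℝ => response β0 w.1 w.2) (Q.prod ν))
    {KX : ℝ} (hX : BoundedDesign Q KX) (β : Fin p → ℝ) :
    Integrable (fun w : ((Fin p → ℝ) × ℝ) × ℝ => |response β0 w.1 w.2 - predictor β w.1|)
      (Q.prod ν) := by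
  have hm : ∀ β : Fin p → ℝ, Measurable fun w : ((Fin p → ℝ) × ℝ) × ℝ =>
      response β0 w.1 w.2 - predictor β w.1 := fun β =>
    (measurable_response β0).sub ((measurable_predictor β).comp measurable_fst)
  have h0 : Integrable (fun w : ((Fin p → ℝ) × ℝ) × ℝ => response β0 w.1 w.2 - predictor β0 w.1)
      (Q.prod ν) := by
    rw [integrable_prod_iff (hm β0).aestronglyMeasurable]
    constructor
    · filter_upwards [hint.prod_right_ae] with z hz
      exact hz.sub (integrable_const _)
    · refine hint.integral_norm_prod_left.mono'
        (hm β0).norm.aestronglyMeasurable.integral_prod_right' ?_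
      filter_upwards [hint.prod_right_ae] with z hz
      have := h.isCondMinimizer hz 0
      simp only [condRisk, sub_zero] at this
      simp only [Real.norm_eq_abs]
      rwa [abs_of_nonneg (integral_nonneg fun _ => abs_nonneg _)]
  have h1 : Integrable (fun w : ((Fin p → ℝ) × ℝ) × ℝ => predictor β0 w.1 - predictor β w.1)
      (Q.prod ν) := by
    refine Integrable.of_bound (C := KX * l1Norm (β0 - β)) (((measurable_predictor β0).comp
      measurable_fst).sub ((measurable_predictor β).comp measurable_fst)).aestronglyMeasurable ?_
    filter_upwards [Measure.quasiMeasurePreserving_fst.ae hX.abs_dotProduct_le] with w hw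
    exact (abs_predictor_sub_le _ _ _).trans (hw _)
  refine (h0.add h1).abs.congr (Filter.Eventually.of_forall fun w => ?_)
  simp

lemma ErrorCondition.risk_eq_integral_condRisk (h : ErrorCondition ν L d)
    (hint : Integrable (fun w : ((Fin p → ℝ) × ℝ) × ℝ => response β0 w.1 w.2) (Q.prod ν))
    {KX : ℝ} (hX : BoundedDesign Q KX) (β : Fin p → ℝ) :
    Integrable (fun z => condRisk ν β0 z (predictor β z)) Q ∧
      risk Q ν β0 (predictor β) = ∫ z, condRisk ν β0 z (predictor β z) ∂Q :=
  ⟨(h.integrable_loss hint hX β).integral_prod_left,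
    integral_prod _ (h.integrable_loss hint hX β)⟩

lemma ErrorCondition.excessRisk_eq (h : ErrorCondition ν L d)
    (hint : Integrable (fun w : ((Fin p → ℝ) × ℝ) × ℝ => response β0 w.1 w.2) (Q.prod ν))
    (hu : UniqueBestPredictor Q ν β0) (f : (Fin p → ℝ) × ℝ → ℝ) :
    excessRisk Q ν β0 f = risk Q ν β0 f - risk Q ν β0 (predictor β0) := by
  rw [excessRisk, risk_congr_ae (h.bestPredictor_ae_eq hint hu)]

/-- The quadratic margin of the excess risk. -/
lemma ErrorCondition.excessRisk_margin (h : ErrorCondition ν L d)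
    (hint : Integrable (fun w : ((Fin p → ℝ) × ℝ) × ℝ => response β0 w.1 w.2) (Q.prod ν))
    {KX K0 : ℝ} (hX : BoundedDesign Q KX) (hu : UniqueBestPredictor Q ν β0) {B : Set (Fin p → ℝ)}
    (hB : BoundedPredictions Q ν β0 B K0) {β : Fin p → ℝ} (hβ : β ∈ B) :
    growthConst K0 d L / 2 * ∫ z, (predictor β z - bestPredictor ν β0 z) ^ 2 ∂Q ≤
      excessRisk Q ν β0 (predictor β) := by
  obtain ⟨i1, e1⟩ := h.risk_eq_integral_condRisk hint hX β
  obtain ⟨i0, e0⟩ := h.risk_eq_integral_condRisk hint hX β0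
  rw [h.excessRisk_eq hint hu, e1, e0, ← integral_sub i1 i0, ← integral_const_mul]
  refine integral_mono_of_nonneg (Filter.Eventually.of_forall fun z =>
    mul_nonneg (div_nonneg (growthConst_pos K0 h.pos L).le zero_le_two) (sq_nonneg _)) (i1.sub i0) ?_
  filter_upwards [hB β hβ, h.bestPredictor_ae_eq hint hu, hint.prod_right_ae] with z hz he hi
  rw [he] at hz ⊢
  exact h.condRisk_margin hi (abs_sub_comm (predictor β z) _ ▸ abs_le.2 hz.2)

end Margin

/-! ### Normalised loss increments and their uniform deviation. -/

section EmpiricalProcess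

/-- For `c ≤ y`, truncation changes the loss at every level in `[-K, K]` by the same amount, so
differences between two such levels survive. -/
lemma abs_clip_sub_max_clip {K y c v : ℝ} (hcy : c ≤ y) (hv : |v| ≤ K) :
    |clip K y - max (clip K c) v| - |clip K y - max (clip K c) 0| =
      |y - max c v| - |y - max c 0| := by
  have hK : 0 ≤ K := (abs_nonneg v).trans hv
  rw [abs_le] at hv
  have cases_clip : ∀ r, (clip K r = K ∧ K ≤ r) ∨ (clip K r = -K ∧ r ≤ -K) ∨
      (clip K r = r ∧ -K ≤ r ∧ r ≤ K) := by
    intro r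
    rcases le_total K r with h | h
    · exact Or.inl ⟨by rw [clip, min_eq_left h, max_eq_right (by linarith)], h⟩
    rcases le_total r (-K) with h' | h'
    · exact Or.inr (Or.inl ⟨by rw [clip, min_eq_right h, max_eq_left h'], h'⟩)
    · exact Or.inr (Or.inr ⟨clip_eq_of_abs_le (abs_le.2 ⟨h', h⟩), h', h⟩)
  have hmax : ∀ s, -K ≤ s → s ≤ K → (max (clip K c) s = max c s ∧ max c s ≤ K) ∨
      (max (clip K c) s = K ∧ max c s = c ∧ K ≤ c) := by
    intro s hs1 hs2
    rcases cases_clip c with ⟨h, h'⟩ | ⟨h, h'⟩ | ⟨h, h', h''⟩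
    · exact Or.inr ⟨by rw [h, max_eq_left hs2], max_eq_left (hs2.trans h'), h'⟩
    · exact Or.inl ⟨by rw [h, max_eq_right hs1, max_eq_right (h'.trans hs1)],
        max_le (by linarith) hs2⟩
    · exact Or.inl ⟨by rw [h], max_le h'' hs2⟩
  have lower : ∀ s, -K ≤ s → -K ≤ max c s := fun s hs => hs.trans (le_max_right _ _)
  have key : ∀ s, -K ≤ s → s ≤ K → |clip K y - max (clip K c) s| =
      |y - max c s| - |y - clip K y| + (if K ≤ c then y - K - (y - c) else 0) := by
    intro s hs1 hs2
    have hl := lower s hs1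
    split_ifs with hKc
    · rcases cases_clip y with ⟨h, h'⟩ | ⟨h, h'⟩ | ⟨h, h', h''⟩
      · have hcc : clip K c = K := by rw [clip, min_eq_left hKc, max_eq_right (by linarith)]
        rw [h, hcc, max_eq_left hs2, max_eq_left (hs2.trans hKc), sub_self, abs_zero,
          abs_of_nonneg (by linarith), abs_of_nonneg (by linarith)]
        ring
      · have : K = 0 := by linarith
        have hy : y = 0 := by linarith
        have hc : c = 0 := by linarith
        have hs : s = 0 := by linarith
        rw [hy, hc, hs, this]; simp [clip]
      · have hy : y = K := by linarith
        have hc : c = K := by linarith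
        rw [hc, hy]; simp [clip_eq_of_abs_le (abs_of_nonneg hK).le]
    · have hm : max (clip K c) s = max c s ∧ max c s ≤ K := by
        rcases hmax s hs1 hs2 with h | h
        · exact h
        · exact absurd h.2.2 hKc
      rw [hm.1]
      rcases cases_clip y with ⟨h, h'⟩ | ⟨h, h'⟩ | ⟨h, h', h''⟩
      · rw [h, abs_of_nonneg (by linarith [hm.2]), abs_of_nonneg (by linarith [hm.2]),
          abs_of_nonneg (by linarith)]
        ring
      · rw [h, abs_of_nonpos (by linarith), abs_of_nonpos (by linarith),
          abs_of_nonpos (by linarith)]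
        ring
      · rw [h]; simp
  rw [key v hv.1 hv.2, key 0 (by linarith) hK]
  ring

variable {p : ℕ}

lemma l1Norm_nonneg (δ : Fin p → ℝ) : 0 ≤ l1Norm δ := Finset.sum_nonneg fun _ _ => abs_nonneg _

lemma eq_zero_of_l1Norm_eq_zero {δ : Fin p → ℝ} (h : l1Norm δ = 0) : δ = 0 := by
  ext j
  simpa using (Finset.sum_eq_zero_iff_of_nonneg fun _ _ => abs_nonneg _).1 h j (Finset.mem_univ j)

/-- The increment `(|y - f_{β⁰ + δ}| - |y - f_{β⁰}|) / ‖δ‖₁` of the loss, computed from truncated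
quantities. -/
def lossIncrement (K : ℝ) (β0 δ : Fin p → ℝ) (w : ((Fin p → ℝ) × ℝ) × ℝ) : ℝ :=
  |clip K ((l1Norm δ)⁻¹ * (response β0 w.1 w.2 - w.1.1 ⬝ᵥ β0)) -
      max (clip K ((l1Norm δ)⁻¹ * (w.1.2 - w.1.1 ⬝ᵥ β0)))
        (∑ j, (l1Norm δ)⁻¹ * δ j * clip K (w.1.1 j))| -
    |clip K ((l1Norm δ)⁻¹ * (response β0 w.1 w.2 - w.1.1 ⬝ᵥ β0)) -
      max (clip K ((l1Norm δ)⁻¹ * (w.1.2 - w.1.1 ⬝ᵥ β0))) 0|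

lemma sum_abs_inv_l1Norm_mul_le (δ : Fin p → ℝ) : ∑ j, |(l1Norm δ)⁻¹ * δ j| ≤ 1 := by
  simp_rw [abs_mul, abs_of_nonneg (inv_nonneg.2 (l1Norm_nonneg δ)), ← Finset.mul_sum]
  exact inv_mul_le_one

lemma abs_sum_clip_le {K : ℝ} (hK : 0 ≤ K) (δ x : Fin p → ℝ) :
    |∑ j, (l1Norm δ)⁻¹ * δ j * clip K (x j)| ≤ K := by
  calc |∑ j, (l1Norm δ)⁻¹ * δ j * clip K (x j)| ≤ ∑ j, |(l1Norm δ)⁻¹ * δ j| * K := by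
        refine (Finset.abs_sum_le_sum_abs _ _).trans (Finset.sum_le_sum fun j _ => ?_)
        rw [abs_mul]
        exact mul_le_mul_of_nonneg_left (abs_clip_le hK _) (abs_nonneg _)
    _ ≤ K := by
        rw [← Finset.sum_mul]
        exact mul_le_of_le_one_left hK (sum_abs_inv_l1Norm_mul_le δ)

lemma abs_lossIncrement_le {K : ℝ} (hK : 0 ≤ K) (β0 δ : Fin p → ℝ)
    (w : ((Fin p → ℝ) × ℝ) × ℝ) : |lossIncrement K β0 δ w| ≤ K := by
  unfold lossIncrement
  refine (abs_abs_sub_abs_le _ _).trans ?_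
  rw [sub_sub_sub_cancel_left, abs_sub_comm, max_comm _ (∑ j, _), max_comm _ (0 : ℝ)]
  refine (abs_max_sub_max_le_abs _ _ _).trans ?_
  rw [sub_zero]
  exact abs_sum_clip_le hK _ _

lemma measurable_clip (K : ℝ) : Measurable (clip K) := by
  unfold clip; fun_prop

lemma measurable_lossIncrement (K : ℝ) (β0 δ : Fin p → ℝ) : Measurable (lossIncrement K β0 δ) := by
  have h1 := measurable_response β0
  have h2 : Measurable fun w : ((Fin p → ℝ) × ℝ) × ℝ => w.1.1 ⬝ᵥ β0 := by
    unfold dotProduct; fun_prop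
  have h3 : Measurable fun w : ((Fin p → ℝ) × ℝ) × ℝ => w.1.2 := by fun_prop
  have h4 := (measurable_clip K).comp ((h1.sub h2).const_mul (l1Norm δ)⁻¹)
  have h5 := (measurable_clip K).comp ((h3.sub h2).const_mul (l1Norm δ)⁻¹)
  have h6 : Measurable fun w : ((Fin p → ℝ) × ℝ) × ℝ =>
      ∑ j, (l1Norm δ)⁻¹ * δ j * clip K (w.1.1 j) :=
    Finset.measurable_fun_sum _ fun j _ => Measurable.const_mul
      ((measurable_clip K).comp ((measurable_pi_apply j).comp
        (measurable_fst.comp measurable_fst))) _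
  exact (h4.sub (h5.max h6)).abs.sub (h4.sub (h5.max measurable_const)).abs

/-- Positive homogeneity of the loss undoes the rescaling, and the truncations are inactive on
differences. At `δ = 0` both sides vanish. -/
lemma l1Norm_mul_lossIncrement {K : ℝ} (hK : 0 ≤ K) (β0 δ : Fin p → ℝ)
    {w : ((Fin p → ℝ) × ℝ) × ℝ} (hw : ∀ j, |w.1.1 j| ≤ K) :
    l1Norm δ * lossIncrement K β0 δ w =
      |response β0 w.1 w.2 - predictor (β0 + δ) w.1| - |response β0 w.1 w.2 - predictor β0 w.1| := by
  rcases (l1Norm_nonneg δ).eq_or_lt with h0 | h0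
  · rw [← h0, eq_zero_of_l1Norm_eq_zero h0.symm]; simp
  have hq := inv_pos.2 h0
  have hcy : (l1Norm δ)⁻¹ * (w.1.2 - w.1.1 ⬝ᵥ β0) ≤
      (l1Norm δ)⁻¹ * (response β0 w.1 w.2 - w.1.1 ⬝ᵥ β0) :=
    mul_le_mul_of_nonneg_left (sub_le_sub_right (le_max_left _ _) _) hq.le
  have hsum : ∑ j, (l1Norm δ)⁻¹ * δ j * clip K (w.1.1 j) = (l1Norm δ)⁻¹ * (w.1.1 ⬝ᵥ δ) := by
    rw [dotProduct, Finset.mul_sum]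
    refine Finset.sum_congr rfl fun j _ => ?_
    rw [clip_eq_of_abs_le (hw j)]; ring
  have key : ∀ v, |(l1Norm δ)⁻¹ * (response β0 w.1 w.2 - w.1.1 ⬝ᵥ β0) -
      max ((l1Norm δ)⁻¹ * (w.1.2 - w.1.1 ⬝ᵥ β0)) ((l1Norm δ)⁻¹ * v)| =
      (l1Norm δ)⁻¹ * |response β0 w.1 w.2 - max (w.1.1 ⬝ᵥ β0 + v) w.1.2| := by
    intro v
    rw [← mul_max_of_nonneg _ _ hq.le, ← mul_sub, abs_mul, abs_of_pos hq, sub_sub, ← max_add_add_left,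
      add_sub_cancel, max_comm]
  have h1 := key (w.1.1 ⬝ᵥ δ)
  have h2 := key 0
  rw [mul_zero, add_zero] at h2
  unfold lossIncrement
  rw [abs_clip_sub_max_clip hcy (abs_sum_clip_le hK δ w.1.1), hsum, h1, h2, ← mul_sub,
    mul_inv_cancel_left₀ h0.ne', predictor, predictor, dotProduct_add]

/-- With high probability the loss increments deviate from their means by a small amount, at all
scales of the increment simultaneously. -/
lemma measure_exists_lossIncrement_le (μ : Measure (((Fin p → ℝ) × ℝ) × ℝ))
    [IsProbabilityMeasure μ] {n : ℕ} (hn : 0 < n) (hp : 2 ≤ p) {K : ℝ} (hK : 0 < K)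
    (β0 : Fin p → ℝ) (D : ℕ → Fin p → ℝ) :
    (Measure.pi fun _ : Fin n => μ) {w | ∃ k, 8 * K * (√(2 * Real.log (2 * p)) * √n) ≤
      ∑ i, ((∫ v, lossIncrement K β0 (D k) v ∂μ) - lossIncrement K β0 (D k) (w i))} ≤
      ENNReal.ofReal (1 / p) := by
  have hn' : (0 : ℝ) < n := by exact_mod_cast hn
  have hp' : (2 : ℝ) ≤ p := by exact_mod_cast hp
  have hlog : 1.28 ≤ Real.log (2 * p) := by
    have h1 : Real.log (2 * 2) ≤ Real.log (2 * p) := Real.log_le_log (by norm_num) (by linarith)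
    rw [Real.log_mul two_ne_zero two_ne_zero] at h1
    linarith [Real.log_two_gt_d9]
  have hx2 := Real.sq_sqrt (show 0 ≤ 2 * Real.log (2 * p) by linarith)
  -- This is where `p ≥ 2` enters: `8 ≤ 5 * x` absorbs the additive constant in `2 * (x + 4) + x ≤ 8
  -- * x`.
  have hx : 1.6 ≤ √(2 * Real.log (2 * p)) := Real.le_sqrt_of_sq_le (by linarith)
  have hy := Real.sqrt_pos.2 hn'
  have hy2 := Real.sq_sqrt hn'.le
  set x := √(2 * Real.log (2 * p)) with hxdef
  set y := √(n : ℝ) with hydef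
  set u := 8 * K * (x * y) with hu
  set E : ℕ → Set (Fin n → ((Fin p → ℝ) × ℝ) × ℝ) := fun N => {w | ∃ k : Fin (N + 1), u ≤
    ∑ i, ((∫ v, lossIncrement K β0 (D k) v ∂μ) - lossIncrement K β0 (D k) (w i))} with hE
  have hunion : {w : Fin n → ((Fin p → ℝ) × ℝ) × ℝ | ∃ k, u ≤
      ∑ i, ((∫ v, lossIncrement K β0 (D k) v ∂μ) - lossIncrement K β0 (D k) (w i))} =
      ⋃ N, E N := by
    ext w
    simp only [hE, Set.mem_ofPred_eq, Set.mem_iUnion]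
    exact ⟨fun ⟨k, hk⟩ => ⟨k, ⟨k, Nat.lt_succ_self k⟩, hk⟩, fun ⟨_, k, hk⟩ => ⟨k, hk⟩⟩
  have hmono : Monotone E := fun N N' hNN' w ⟨k, hk⟩ => ⟨⟨k, k.2.trans_le (by omega)⟩, hk⟩
  -- The bound for finite classes does not depend on their size, so it passes to the countable class
  -- by continuity from below.
  rw [hunion, hmono.measure_iUnion]
  refine iSup_le fun N => ?_
  have hdev := measure_exists_sum_ge_le (μ := μ) (T := Fin (N + 1))
    (g := fun w k => lossIncrement K β0 (D k) w) (K := K)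
    (a := K * ((x + 4) * y)) (r := K * (x * y)) (u := u)
    (measurable_pi_lambda _ fun k => measurable_lossIncrement K β0 _) hK
    (fun w => (pi_norm_le_iff_of_nonneg hK.le).2 fun k => abs_lossIncrement_le hK.le _ _ _) hn
    (fun l hl => by
      have := signedMax_censored_le (ι := ((Fin p → ℝ) × ℝ) × ℝ) (T := Fin (N + 1)) (by omega)
        (fun w j => clip K (w.1.1 j)) hK (fun w j => abs_clip_le hK.le _)
        (fun k j => (l1Norm (D k))⁻¹ * D k j) (fun k => sum_abs_inv_l1Norm_mul_le _)
        (fun k => (l1Norm (D k))⁻¹) (fun k => inv_nonneg.2 (l1Norm_nonneg _))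
        (fun w => response β0 w.1 w.2 - w.1.1 ⬝ᵥ β0) (fun w => w.1.2 - w.1.1 ⬝ᵥ β0)
        (fun w => sub_le_sub_right (le_max_left _ _) _) l (by omega)
      rw [hl] at this
      exact this)
    (by positivity) (by
      have : 8 * y ≤ 5 * x * y := mul_le_mul_of_nonneg_right (by linarith) hy.le
      have := mul_le_mul_of_nonneg_left this hK.le
      rw [hu]; nlinarith)
  refine hdev.trans (ENNReal.ofReal_le_ofReal ?_)
  -- With `r = K * x * y` the tail is exactly `1 / (2p)`.
  have e : (K * (x * y)) ^ 2 / (2 * n * K ^ 2) = Real.log (2 * p) := by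
    rw [mul_pow, mul_pow, hx2, hy2]; field_simp
  rw [e, Real.exp_neg, Real.exp_log (by linarith), one_div]
  exact inv_anti₀ (by linarith) (by linarith)

end EmpiricalProcess

/-! ### The deviation event and the oracle inequality. -/

section Oracle

variable {p : ℕ} {Q : Measure ((Fin p → ℝ) × ℝ)} {ν : Measure ℝ} {β0 : Fin p → ℝ}

lemma continuous_l1Norm : Continuous (l1Norm : (Fin p → ℝ) → ℝ) := by
  unfold l1Norm; fun_prop

/-- The increment of the loss at the observation `w` from `β⁰` to `β⁰ + δ`. -/
def lossDiff (β0 δ : Fin p → ℝ) (w : ((Fin p → ℝ) × ℝ) × ℝ) : ℝ :=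
  |response β0 w.1 w.2 - predictor (β0 + δ) w.1| - |response β0 w.1 w.2 - predictor β0 w.1|

lemma measurable_lossDiff (β0 δ : Fin p → ℝ) : Measurable (lossDiff β0 δ) := by
  have h := fun β : Fin p → ℝ =>
    ((measurable_response β0).sub ((measurable_predictor β).comp measurable_fst)).abs
  exact (h (β0 + δ)).sub (h β0)

lemma continuous_lossDiff (β0 : Fin p → ℝ) (w : ((Fin p → ℝ) × ℝ) × ℝ) :
    Continuous fun δ => lossDiff β0 δ w := by
  unfold lossDiff predictor dotProduct
  fun_prop

lemma abs_lossDiff_le (β0 δ : Fin p → ℝ) (w : ((Fin p → ℝ) × ℝ) × ℝ) :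
    |lossDiff β0 δ w| ≤ |w.1.1 ⬝ᵥ δ| := by
  refine (abs_abs_sub_abs_le _ _).trans ?_
  rw [sub_sub_sub_cancel_left]
  have := abs_predictor_sub_le β0 (β0 + δ) w.1
  rwa [sub_add_cancel_left, dotProduct_neg, abs_neg] at this

lemma BoundedDesign.pos (hp : 0 < p) {KX : ℝ} (hX : BoundedDesign Q KX) (hs : Scaled Q) :
    0 < KX := by
  by_contra! h
  have h1 := hs ⟨0, hp⟩
  rw [integral_eq_zero_of_ae] at h1
  · exact zero_ne_one h1
  · filter_upwards [hX ⟨0, hp⟩] with z hz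
    simp [abs_nonpos_iff.1 (hz.trans h)]

variable [IsProbabilityMeasure ν] [IsProbabilityMeasure Q]

lemma BoundedDesign.continuous_integral_lossDiff {KX : ℝ} (hK : 0 ≤ KX) (hX : BoundedDesign Q KX) :
    Continuous fun δ => ∫ w, lossDiff β0 δ w ∂(Q.prod ν) := by
  refine continuous_iff_continuousAt.2 fun δ₀ => continuousAt_of_dominated
    (bound := fun _ => KX * (l1Norm δ₀ + 1))
    (Filter.Eventually.of_forall fun δ => (measurable_lossDiff β0 δ).aestronglyMeasurable) ?_
    (integrable_const _)
    (Filter.Eventually.of_forall fun w => (continuous_lossDiff β0 w).continuousAt)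
  filter_upwards [continuous_l1Norm.continuousAt.eventually_lt_const (lt_add_one (l1Norm δ₀))]
    with δ hδ
  filter_upwards [Measure.quasiMeasurePreserving_fst.ae hX.abs_dotProduct_le] with w hw
  exact (abs_lossDiff_le β0 δ w).trans ((hw δ).trans (mul_le_mul_of_nonneg_left hδ.le hK))

lemma ErrorCondition.excessRisk_eq_integral_lossDiff {L : ℝ≥0} {d : ℝ} (h : ErrorCondition ν L d)
    (hint : Integrable (fun w : ((Fin p → ℝ) × ℝ) × ℝ => response β0 w.1 w.2) (Q.prod ν))
    {KX : ℝ} (hX : BoundedDesign Q KX) (hu : UniqueBestPredictor Q ν β0) (δ : Fin p → ℝ) :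
    excessRisk Q ν β0 (predictor (β0 + δ)) = ∫ w, lossDiff β0 δ w ∂(Q.prod ν) := by
  rw [h.excessRisk_eq hint hu]
  exact (integral_sub (h.integrable_loss hint hX _) (h.integrable_loss hint hX _)).symm

/-- The uniform deviation event for the empirical loss. -/
lemma IsSample.exists_deviation_event {Ω : Type*} [MeasurableSpace Ω] {P : Measure Ω}
    [IsProbabilityMeasure P] {n : ℕ} (hn : 0 < n) (hp : 2 ≤ p) {x : Fin n → Ω → Fin p → ℝ}
    {c ε : Fin n → Ω → ℝ} (hs : IsSample P Q ν x c ε) {KX : ℝ} (hK : 0 < KX)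
    (hX : BoundedDesign Q KX) :
    ∃ A : Set Ω, MeasurableSet A ∧ 1 - 1 / (p : ℝ) ≤ P.real A ∧ ∀ ω ∈ A, ∀ δ,
      n * ∫ w, lossDiff β0 δ w ∂(Q.prod ν) - ∑ i, lossDiff β0 δ ((x i ω, c i ω), ε i ω) ≤
        8 * KX * (√(2 * Real.log (2 * p)) * √n) * l1Norm δ := by
  set μ := Q.prod ν with hμ
  set W : Fin n → Ω → ((Fin p → ℝ) × ℝ) × ℝ := fun i ω => ((x i ω, c i ω), ε i ω) with hW
  set D : ℕ → Fin p → ℝ := TopologicalSpace.denseSeq (Fin p → ℝ)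
  have hWm : ∀ i, AEMeasurable (W i) P := fun i => (hs.law i).aemeasurable
  have hmap : P.map (fun ω i => W i ω) = Measure.pi fun _ => μ := by
    rw [(iIndepFun_iff_map_fun_eq_pi_map hWm).1 hs.indep]
    congr 1
    ext1 i
    exact (hs.law i).map_eq
  set u := 8 * KX * (√(2 * Real.log (2 * p)) * √n) with hu
  set E : Set (Fin n → ((Fin p → ℝ) × ℝ) × ℝ) := {w | ∃ k, u ≤
    ∑ i, ((∫ v, lossIncrement KX β0 (D k) v ∂μ) - lossIncrement KX β0 (D k) (w i))} with hE
  have hEm : MeasurableSet E := by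
    have : E = ⋃ k, {w | u ≤
        ∑ i, ((∫ v, lossIncrement KX β0 (D k) v ∂μ) - lossIncrement KX β0 (D k) (w i))} := by
      ext w; simp [hE]
    rw [this]
    exact MeasurableSet.iUnion fun k => measurableSet_le measurable_const
      (Finset.measurable_fun_sum _ fun i _ =>
        ((measurable_lossIncrement KX β0 (D k)).comp (measurable_pi_apply i)).const_sub _)
  have hPE : P ((fun ω i => W i ω) ⁻¹' E) ≤ ENNReal.ofReal (1 / p) := by
    rw [← Measure.map_apply_of_aemeasurable (aemeasurable_pi_lambda _ hWm) hEm, hmap]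
    exact measure_exists_lossIncrement_le μ hn hp hK β0 D
  have hdesign : ∀ᵐ w ∂μ, ∀ j, |w.1.1 j| ≤ KX :=
    Measure.quasiMeasurePreserving_fst.ae (ae_all_iff.2 hX)
  have hnull : P {ω | ∀ i j, |x i ω j| ≤ KX}ᶜ = 0 := by
    have h : ∀ᵐ ω ∂P, ∀ i j, |x i ω j| ≤ KX := ae_all_iff.2 fun i => by
      have h2 := hdesign
      rw [hμ, ← (hs.law i).map_eq] at h2
      exact ae_of_ae_map (hWm i) h2
    exact h
  set N := (fun ω i => W i ω) ⁻¹' E ∪ {ω | ∀ i j, |x i ω j| ≤ KX}ᶜ with hN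
  have hPN : P N ≤ ENNReal.ofReal (1 / p) := by
    refine (measure_union_le _ _).trans ?_
    rw [hnull, add_zero]
    exact hPE
  -- The observations are only almost everywhere measurable, so the bad set is enlarged to a
  -- measurable set of the same measure.
  refine ⟨(toMeasurable P N)ᶜ, (measurableSet_toMeasurable P N).compl, ?_, fun ω hω δ => ?_⟩
  · rw [probReal_compl_eq_one_sub (measurableSet_toMeasurable P N), measureReal_def,
      measure_toMeasurable]
    have := ENNReal.toReal_mono ENNReal.ofReal_ne_top hPN
    rw [ENNReal.toReal_ofReal (by positivity)] at this
    linarith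
  · have hωN : ω ∉ N := fun h => hω (subset_toMeasurable P N h)
    simp only [hN, Set.mem_union, not_or, Set.mem_compl_iff, not_not, Set.mem_preimage, hE,
      Set.mem_ofPred_eq, not_exists, not_le] at hωN
    obtain ⟨h1, h2⟩ := hωN
    -- Both sides of the deviation inequality are continuous in `δ`, so the dense sequence suffices.
    refine (TopologicalSpace.denseRange_denseSeq (Fin p → ℝ)).induction_on
      (p := fun δ => n * ∫ w, lossDiff β0 δ w ∂μ - ∑ i, lossDiff β0 δ (W i ω) ≤ u * l1Norm δ) δ
      (isClosed_le ?_ (continuous_l1Norm.const_mul u)) fun k => ?_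
    · exact ((hX.continuous_integral_lossDiff hK.le).const_mul _).sub
        (continuous_finsetSum _ fun i _ => continuous_lossDiff β0 (W i ω))
    · have h3 := mul_le_mul_of_nonneg_right (h1 k).le (l1Norm_nonneg (D k))
      refine le_trans (le_of_eq ?_) h3
      have h4 : ∫ w, lossDiff β0 (D k) w ∂μ =
          l1Norm (D k) * ∫ w, lossIncrement KX β0 (D k) w ∂μ := by
        rw [← integral_const_mul]
        refine integral_congr_ae ?_
        filter_upwards [hdesign] with w hw
        exact (l1Norm_mul_lossIncrement hK.le β0 (D k) hw).symm
      have h5 : ∀ i, lossDiff β0 (D k) (W i ω) =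
          l1Norm (D k) * lossIncrement KX β0 (D k) (W i ω) := fun i =>
        (l1Norm_mul_lossIncrement hK.le β0 (D k) (h2 i)).symm
      change n * ∫ w, lossDiff β0 (D k) w ∂μ - ∑ i, lossDiff β0 (D k) (W i ω) = _
      rw [h4, Finset.sum_congr rfl fun i _ => h5 i, ← Finset.mul_sum, Finset.sum_sub_distrib]
      simp only [Finset.sum_const, Finset.card_univ, Fintype.card_fin, nsmul_eq_mul]
      ring

lemma l1Norm_eq_add (S : Finset (Fin p)) (δ : Fin p → ℝ) :
    l1Norm δ = l1Norm (restrictTo S δ) + l1Norm (restrictTo Sᶜ δ) := by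
  unfold l1Norm restrictTo
  rw [← Finset.sum_add_distrib]
  refine Finset.sum_congr rfl fun j _ => ?_
  by_cases h : j ∈ S <;> simp [h]

/-- Off the active set `β0` vanishes and the penalty difference is exact; on it the triangle
inequality is used. -/
lemma l1Norm_sub_l1Norm_le (β0 β : Fin p → ℝ) :
    l1Norm β0 - l1Norm β ≤ l1Norm (restrictTo (activeSet β0) (β - β0)) -
      l1Norm (restrictTo (activeSet β0)ᶜ (β - β0)) := by
  unfold l1Norm restrictTo
  rw [← Finset.sum_sub_distrib, ← Finset.sum_sub_distrib]
  refine Finset.sum_le_sum fun j _ => ?_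
  by_cases h : β0 j = 0
  · simp [activeSet, h]
  · simp only [activeSet, Finset.mem_filter, Finset.mem_univ, true_and, ne_eq, h, not_false_eq_true,
      if_true, Finset.mem_compl, not_true_eq_false, if_false, abs_zero, sub_zero, Pi.sub_apply]
    rw [abs_sub_comm]
    exact abs_sub_abs_le_abs_sub _ _

lemma BoundedDesign.secondMoment_form {KX : ℝ} (hX : BoundedDesign Q KX) (δ : Fin p → ℝ) :
    δ ⬝ᵥ (secondMoment Q).mulVec δ = ∫ z, (z.1 ⬝ᵥ δ) ^ 2 ∂Q := by
  have hi : ∀ j k, Integrable (fun z : (Fin p → ℝ) × ℝ => z.1 j * z.1 k) Q := fun j k => by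
    refine Integrable.of_bound (C := KX * KX) (by fun_prop) ?_
    filter_upwards [hX j, hX k] with z h1 h2
    rw [norm_mul]
    exact mul_le_mul h1 h2 (abs_nonneg _) ((abs_nonneg _).trans h1)
  have e : (fun z : (Fin p → ℝ) × ℝ => (z.1 ⬝ᵥ δ) ^ 2) =
      fun z => ∑ j, ∑ k, δ j * δ k * (z.1 j * z.1 k) := by
    ext z
    rw [dotProduct, sq, Finset.sum_mul_sum]
    exact Finset.sum_congr rfl fun j _ => Finset.sum_congr rfl fun k _ => by ring
  rw [e, integral_finsetSum _ fun j _ => integrable_finsetSum _ fun k _ => (hi j k).const_mul _]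
  unfold dotProduct
  refine Finset.sum_congr rfl fun j _ => ?_
  rw [integral_finsetSum _ fun k _ => (hi j k).const_mul _, Matrix.mulVec, dotProduct,
    Finset.mul_sum]
  refine Finset.sum_congr rfl fun k _ => ?_
  rw [integral_const_mul, secondMoment]
  ring

lemma IsEstimate.sum_lossDiff_le {n : ℕ} (hn : 0 < n) {B : Set (Fin p → ℝ)}
    {x : Fin n → Fin p → ℝ} {c ε y : Fin n → ℝ} {lam : ℝ} {b : Fin p → ℝ}
    (h : IsEstimate B x c y lam b) (hβ0 : β0 ∈ B) (hy : ∀ i, y i = max (c i) (x i ⬝ᵥ β0 + ε i)) :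
    ∑ i, lossDiff β0 (b - β0) ((x i, c i), ε i) ≤ n * (lam * (l1Norm β0 - l1Norm b)) := by
  have hn' : (0 : ℝ) < n := by exact_mod_cast hn
  have h1 := mul_le_mul_of_nonneg_left (h.2 β0 hβ0) hn'.le
  unfold criterion at h1
  rw [mul_add, mul_add, one_div, mul_inv_cancel_left₀ hn'.ne', mul_inv_cancel_left₀ hn'.ne'] at h1
  have h2 : ∑ i, lossDiff β0 (b - β0) ((x i, c i), ε i) =
      ∑ i, |y i - max (c i) (x i ⬝ᵥ b)| - ∑ i, |y i - max (c i) (x i ⬝ᵥ β0)| := by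
    rw [← Finset.sum_sub_distrib]
    refine Finset.sum_congr rfl fun i _ => ?_
    rw [lossDiff, add_sub_cancel, predictor, predictor, response, hy, max_comm (x i ⬝ᵥ b),
      max_comm (x i ⬝ᵥ β0)]
  rw [h2]
  linarith

/-- The two error bounds follow from the basic inequality and the quadratic margin. -/
lemma bounds_of_basic_inequality {E a s lam X : ℝ} (hE : 0 ≤ E) (ha : 0 ≤ a) (hs : 0 ≤ s)
    (hX : 0 ≤ X) (hlam : 0 < lam) (hbasic : E + lam / 2 * a ≤ 3 * lam / 2 * s)
    (hs2 : s ^ 2 ≤ E * X) : E ≤ lam ^ 2 * (9 * X) ∧ s + a ≤ lam * (6 * X) := by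
  -- The inequality `2 λ √(E X) ≤ E / 2 + 2 λ² X`. Adding `λ s / 2` to the basic inequality then
  -- gives `E / 2 + λ (s + a) / 2 ≤ 2 λ² X`, so 4 would do in place of both 9 and 6.
  have h1 : 2 * lam * s ≤ E / 2 + 2 * lam ^ 2 * X := by
    refine le_of_sq_le_sq ?_ (by positivity)
    nlinarith [sq_nonneg (E / 2 - 2 * lam ^ 2 * X), mul_le_mul_of_nonneg_left hs2 (sq_nonneg lam)]
  have h2 : 0 ≤ lam ^ 2 * X := by positivity
  have h3 : 0 ≤ lam * (s + a) := by positivity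
  refine ⟨by linarith, ?_⟩
  have h4 : lam * (s + a) ≤ lam * (4 * lam * X) := by nlinarith
  have h5 := le_of_mul_le_mul_left h4 hlam
  have h6 : 0 ≤ lam * X := by positivity
  linarith

/-- The oracle inequality on the event where the empirical loss is uniformly close to its mean. -/
lemma IsEstimate.oracle_bounds {n : ℕ} (hn : 0 < n) {B : Set (Fin p → ℝ)} {x : Fin n → Fin p → ℝ}
    {c ε y : Fin n → ℝ} {lam KX K0 C2 d φ0 : ℝ} {L : ℝ≥0} {b : Fin p → ℝ}
    (h : IsEstimate B x c y lam b) (hβ0 : β0 ∈ B) (hy : ∀ i, y i = max (c i) (x i ⬝ᵥ β0 + ε i))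
    (hint : Integrable (fun w : ((Fin p → ℝ) × ℝ) × ℝ => response β0 w.1 w.2) (Q.prod ν))
    (hX : BoundedDesign Q KX) (hB : BoundedPredictions Q ν β0 B K0)
    (hu : UniqueBestPredictor Q ν β0) (hν : ErrorCondition ν L d) (hC2 : 0 < C2)
    (hcens : CensoringCondition Q ν β0 C2) (hcomp : CompatibilityCondition Q β0 φ0)
    (hlam : 0 < lam)
    (hdev : n * ∫ w, lossDiff β0 (b - β0) w ∂(Q.prod ν) -
      ∑ i, lossDiff β0 (b - β0) ((x i, c i), ε i) ≤ n * (lam / 2) * l1Norm (b - β0)) :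
    excessRisk Q ν β0 (predictor b) ≤
        lam ^ 2 * (9 * (activeSet β0).card * (C2 * (growthConst K0 d L / 2))⁻¹ / φ0 ^ 2) ∧
      l1Norm (b - β0) ≤
        lam * (6 * (C2 * (growthConst K0 d L / 2))⁻¹ * (activeSet β0).card / φ0 ^ 2) := by
  have hn' : (0 : ℝ) < n := by exact_mod_cast hn
  have hκ := half_pos (growthConst_pos K0 hν.pos L)
  have hmargin := hν.excessRisk_margin hint hX hu hB h.1
  have hE := hν.excessRisk_eq_integral_lossDiff hint hX hu (b - β0)
  rw [add_sub_cancel] at hE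
  rw [← hE] at hdev
  set κ := growthConst K0 d L / 2
  set E := excessRisk Q ν β0 (predictor b)
  have hE0 : 0 ≤ E :=
    (mul_nonneg hκ.le (integral_nonneg fun _ => sq_nonneg _)).trans hmargin
  have hsum := h.sum_lossDiff_le hn hβ0 hy
  have hnorm := l1Norm_sub_l1Norm_le β0 b
  have hsplit := l1Norm_eq_add (activeSet β0) (b - β0)
  have ha := l1Norm_nonneg (restrictTo (activeSet β0)ᶜ (b - β0))
  have hs := l1Norm_nonneg (restrictTo (activeSet β0) (b - β0))
  have hcone : l1Norm (restrictTo (activeSet β0)ᶜ (b - β0)) ≤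
      3 * l1Norm (restrictTo (activeSet β0) (b - β0)) → InCone β0 b := id
  have hcomp' := fun hc => hcomp b (hcone hc)
  rw [hX.secondMoment_form] at hcomp'
  set a := l1Norm (restrictTo (activeSet β0)ᶜ (b - β0))
  set s := l1Norm (restrictTo (activeSet β0) (b - β0))
  have hbasic : E + lam / 2 * a ≤ 3 * lam / 2 * s := by
    have h1 : n * E ≤ n * (lam * (s - a) + lam / 2 * (s + a)) := by
      have := mul_le_mul_of_nonneg_left (mul_le_mul_of_nonneg_left hnorm hlam.le) hn'.le
      rw [hsplit] at hdev
      linarith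
    linarith [le_of_mul_le_mul_left h1 hn']
  -- Nonnegativity of the excess risk puts the estimate in the cone, where the censoring and
  -- compatibility conditions may be applied.
  have hc : a ≤ 3 * s := by
    have : lam / 2 * a ≤ lam / 2 * (3 * s) := by linarith
    exact le_of_mul_le_mul_left this (by positivity)
  have hG : ∫ z, (z.1 ⬝ᵥ (b - β0)) ^ 2 ∂Q ≤ (C2 * κ)⁻¹ * E := by
    have h1 := mul_le_mul_of_nonneg_left (hcens b (hcone hc)) hκ.le
    rw [inv_mul_eq_div, le_div_iff₀ (mul_pos hC2 hκ)]
    linarith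
  have hX0 : 0 ≤ ((activeSet β0).card : ℝ) / φ0 ^ 2 := by positivity
  have hs2 : s ^ 2 ≤ E * ((C2 * κ)⁻¹ * ((activeSet β0).card / φ0 ^ 2)) :=
    (hcomp' hc).trans ((mul_le_mul_of_nonneg_right hG hX0).trans (le_of_eq (by ring)))
  obtain ⟨h1, h2⟩ := bounds_of_basic_inequality hE0 ha hs
    (mul_nonneg (inv_nonneg.2 (mul_pos hC2 hκ).le) hX0) hlam hbasic hs2
  rw [hsplit]
  exact ⟨h1.trans (le_of_eq (by ring)), h2.trans (le_of_eq (by ring))⟩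

end Oracle

lemma lambdaFun_bounds {n p : ℕ} (hn : 0 < n) (hp : 0 < p) {KX t lam : ℝ} (hK : 0 < KX)
    (hlam : 4 * lambdaFun n p KX t ≤ lam) :
    0 < lam ∧ 8 * KX * (√(2 * Real.log (2 * p)) * √n) ≤ n * (lam / 2) := by
  have hn' : (0 : ℝ) < n := by exact_mod_cast hn
  have hlog : 0 < Real.log (2 * p) := Real.log_pos (by
    have : (1 : ℝ) ≤ p := by exact_mod_cast hp
    linarith)
  unfold lambdaFun at hlam
  rw [Real.sqrt_div (by positivity)] at hlam
  have h1 : 0 ≤ KX * √(8 * t / n) := by positivity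
  have hy := Real.sqrt_pos.2 hn'
  have hy2 := Real.sq_sqrt hn'.le
  have hx := Real.sqrt_pos.2 (mul_pos two_pos hlog)
  set x := √(2 * Real.log (2 * p))
  set y := √(n : ℝ)
  have h2 : 0 < 4 * KX * (x / y) := by positivity
  refine ⟨by linarith, ?_⟩
  -- Four times the first term of `lambdaFun` is `16 * KX * x / y`; the term in `t` is nonnegative
  -- and is dropped.
  have h3 : 8 * KX * (x / y) ≤ lam / 2 := by linarith
  refine le_trans (le_of_eq ?_) (mul_le_mul_of_nonneg_left h3 hn'.le)
  rw [← hy2]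
  field_simp

end CensoredLinear

end

theorem theorem1 (K0 C2 : ℝ) (hC2 : 0 < C2) (L : ℝ≥0) (d : ℝ) (hd : 0 < d) :
    ∃ C : ℝ, 0 < C ∧
      ∀ (n p : ℕ) (_hn : 0 < n) (_hp : 0 < p)
        (Ω : Type*) [MeasurableSpace Ω] (P : Measure Ω) [IsProbabilityMeasure P]
        (Q : Measure ((Fin p → ℝ) × ℝ)) [IsProbabilityMeasure Q]
        (ν : Measure ℝ) [IsProbabilityMeasure ν]
        (x : Fin n → Ω → Fin p → ℝ) (c ε y : Fin n → Ω → ℝ)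
        (β0 : Fin p → ℝ) (B : Set (Fin p → ℝ)) (KX φ0 t lam : ℝ)
        (_hsample : CensoredLinear.IsSample P Q ν x c ε)
        (_hy : ∀ i ω, y i ω = max (c i ω) (x i ω ⬝ᵥ β0 + ε i ω))
        (_hint : Integrable
          (fun w : ((Fin p → ℝ) × ℝ) × ℝ => CensoredLinear.response β0 w.1 w.2) (Q.prod ν))
        (_hB : Bornology.IsBounded B) (_hβ0 : β0 ∈ B)
        (_h1 : CensoredLinear.BoundedDesign Q KX)
        (_h2 : CensoredLinear.BoundedPredictions Q ν β0 B K0)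
        (_h3 : CensoredLinear.Scaled Q)
        (_h4 : CensoredLinear.UniqueBestPredictor Q ν β0)
        (_h5 : CensoredLinear.ErrorCondition ν L d)
        (_h6 : CensoredLinear.CensoringCondition Q ν β0 C2)
        (_hφ0 : 0 < φ0) (_h7 : CensoredLinear.CompatibilityCondition Q β0 φ0)
        (_ht : 0 ≤ t) (_hlam : 4 * CensoredLinear.lambdaFun n p KX t ≤ lam),
        ∃ A : Set Ω, MeasurableSet A ∧ 1 - 1 / (p : ℝ) ≤ P.real A ∧
          ∀ ω ∈ A, ∀ b : Fin p → ℝ,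
            CensoredLinear.IsEstimate B (fun i => x i ω) (fun i => c i ω) (fun i => y i ω) lam b →
              CensoredLinear.excessRisk Q ν β0 (CensoredLinear.predictor b) ≤
                  lam ^ 2 * (9 * (CensoredLinear.activeSet β0).card * C / φ0 ^ 2) ∧
              CensoredLinear.l1Norm (b - β0) ≤
                  lam * (6 * C * (CensoredLinear.activeSet β0).card / φ0 ^ 2) := by
  -- The reciprocal of the censoring constant times the margin constant: the factor converting
  -- excess risk into `E (x(β - β⁰))²`.
  refine ⟨(C2 * (CensoredLinear.growthConst K0 d L / 2))⁻¹,
    inv_pos.2 (mul_pos hC2 (half_pos (CensoredLinear.growthConst_pos K0 hd L))), ?_⟩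
  intro n p hn hp Ω _ P _ Q _ ν _ x c ε y β0 B KX φ0 t lam hsample hy hint _ hβ0 h1 h2 h3 h4 h5 h6 _ h7
    _ hlam
  have hK := h1.pos hp h3
  obtain ⟨hlam0, hu⟩ := CensoredLinear.lambdaFun_bounds hn hp hK hlam
  rcases (Nat.succ_le_of_lt hp).eq_or_lt with rfl | hp2
  -- For `p = 1` the required probability is `0`, so the empty event suffices.
  · exact ⟨∅, MeasurableSet.empty, by simp, fun ω hω => hω.elim⟩
  obtain ⟨A, hA, hPA, hdev⟩ := hsample.exists_deviation_event (β0 := β0) hn hp2 hK h1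
  refine ⟨A, hA, hPA, fun ω hω b hb => hb.oracle_bounds hn hβ0 (fun i => hy i ω) hint h1 h2 h4 h5 hC2
    h6 h7 hlam0 ((hdev ω hω (b - β0)).trans ?_)⟩
  exact mul_le_mul_of_nonneg_right hu (CensoredLinear.l1Norm_nonneg _)
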